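/- Let $\mathbb F\in\{\mathbb R,\mathbb C\}$ and let $A-\lambda B$ be a pencil with $A,B\in\mathbb F^{n\times n}$ of normal rank $\max_{\zeta}\operatorname{rank}(A-\zeta B)=n-k$, where $k\ge 1$. Let $\lambda_0\in\mathbb F$ be a finite simple eigenvalue of $A-\lambda B$, that is, an eigenvalue (a number with $\operatorname{rank}(A-\lambda_0B)<n-k$) that is a simple root of $\det R(\lambda)$, where $R(\lambda)$ is the regular part in the Kronecker canonical form of $A-\lambda B$. A subspace $\mathcal M\subseteq\mathbb F^n$ is called reducing for $A-\lambda B$ if $\dim(A\mathcal M+B\mathcal M)=\dim\mathcal M-k$; let $\mathcal M_{\rm RS}$ be the intersection of all reducing subspaces of $A-\lambda B$, and $\mathcal L_{\rm RS}$ the intersection of all reducing subspaces of $A^*-\lambda B^*$. Let $X=[X_1\ x]$ and $Y=[Y_1\ y]$ be $n\times(k+1)$ matrices over $\mathbb F$ with orthonormal columns such that the columns of $X$, $X_1$, $Y$, $Y_1$ are bases of $\ker(A-\lambda_0B)$, $\ker(A-\lambda_0B)\cap\mathcal M_{\rm RS}$, $\ker((A-\lambda_0B)^*)$, $\ker((A-\lambda_0B)^*)\cap\mathcal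 L_{\rm RS}$, respectively. Let $\tau\in\mathbb F\setminus\{0\}$ and let $D_A,D_B\in\mathbb F^{k\times k}$ be diagonal matrices such that $D_A-\lambda_0D_B$ is nonsingular. Let $U$ and $V$ be random $n\times k$ matrices (not necessarily independent), each distributed uniformly on the Stiefel manifold $\{Q\in\mathbb F^{n\times k}: Q^*Q=I\}$, i.e. according to its unique probability measure invariant under left multiplication by orthogonal ($\mathbb F=\mathbb R$) or unitary ($\mathbb F=\mathbb C$) matrices. Consider the perturbed pencil $$\widetilde A-\lambda\widetilde B=A-\lambda B+\tau\,(UD_AV^*-\lambda\,UD_BV^*).$$ Almost surely, whenever this pencil is regular, let $x_0,y_0\in\mathbb F^n$ be right and left eigenvectors of it for $\lambda_0$ with $\|x_0\|_2=\|y_0\|_2=1$. Let $\alpha_{\mathbb F}=x^*x_0$ and $\beta_{\mathbb F}=y^*y_0$ be the coefficients of $x$ and $y$ in the expansions $x_0=X_1a+\alpha_{\mathbb F}\,x$ and $y_0=Y_1b+\beta_{\mathbb F}\,y$. Then for every $0\le t\le 1$ $$\mathbb P\big(|\alpha_{\mathbb C}||\beta_{\mathbb C}|<t\big)\le 2kt\quad\text{if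 }\mathbb F=\mathbb C,\qquad \mathbb P\big(|\alpha_{\mathbb R}||\beta_{\mathbb R}|<t\big)\le\sqrt{8kt/\pi}\quad\text{if }\mathbb F=\mathbb R.$$ -/

import Mathlib

open MeasureTheory Polynomial

namespace SingularPencil

/-- Matrices carry the product sigma-algebra of their entries. -/
instance instMeasurableSpaceMatrix {m n R : Type*} [MeasurableSpace R] :
    MeasurableSpace (Matrix m n R) :=
  inferInstanceAs (MeasurableSpace (m → n → R))

section Pencils

variable {𝕜 : Type*} [RCLike 𝕜] {n : ℕ}

/-- The normal rank `max_ζ rank (A - ζ B)` of the pencil `A - λ B`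
(a supremum of natural numbers bounded by `n`). -/
noncomputable def normalRank (A B : Matrix (Fin n) (Fin n) 𝕜) : ℕ :=
  ⨆ z : 𝕜, (A - z • B).rank

/-- The square pencil `A - λ B` is regular: `det (A - λ B)` does not vanish identically. -/
def IsRegularPencil (A B : Matrix (Fin n) (Fin n) 𝕜) : Prop :=
  ∃ z : 𝕜, (A - z • B).det ≠ 0

/-- `z` is a finite eigenvalue of the (possibly singular) pencil `A - λ B`. -/
def IsEigenvalue (A B : Matrix (Fin n) (Fin n) 𝕜) (z : 𝕜) : Prop :=
  (A - z • B).rank < normalRank A B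

/-- The pencil `A - λ B` as a matrix of polynomials in `λ`. -/
noncomputable def pencil {m l : Type*} (A B : Matrix m l 𝕜) : Matrix m l 𝕜[X] :=
  A.map C - (X : 𝕜[X]) • B.map C

/-- The Kronecker block `L_j(λ) = [0 I_j] - λ [I_j 0]` of size `j × (j + 1)`. -/
noncomputable def kroneckerBlock (𝕜 : Type*) [RCLike 𝕜] (j : ℕ) :
    Matrix (Fin j) (Fin (j + 1)) 𝕜[X] :=
  pencil (Matrix.of fun a b => if b = a.succ then 1 else 0)
    (Matrix.of fun a b => if b = a.castSucc then 1 else 0)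

/-- The regular part `R(λ) = diag (J - λ I_r, I_s - λ N)`. -/
noncomputable def regularPart {r s : ℕ} (J : Matrix (Fin r) (Fin r) 𝕜)
    (N : Matrix (Fin s) (Fin s) 𝕜) : Matrix (Fin r ⊕ Fin s) (Fin r ⊕ Fin s) 𝕜[X] :=
  Matrix.fromBlocks (pencil J 1) 0 0 (pencil 1 N)

/-- The singular part
`S(λ) = diag (L_{m_1}(λ), …, L_{m_k}(λ), L_{l_1}(λ)ᵀ, …, L_{l_k}(λ)ᵀ)`. -/
noncomputable def singularPart (𝕜 : Type*) [RCLike 𝕜] {k : ℕ} (m l : Fin k → ℕ) :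
    Matrix ((Σ i, Fin (m i)) ⊕ (Σ i, Fin (l i + 1))) ((Σ i, Fin (m i + 1)) ⊕ (Σ i, Fin (l i)))
      𝕜[X] :=
  Matrix.fromBlocks (Matrix.blockDiagonal' fun i => kroneckerBlock 𝕜 (m i)) 0 0
    (Matrix.blockDiagonal' fun i => (kroneckerBlock 𝕜 (l i)).transpose)

/-- `P (A - λ B) Q = diag (R(λ), S(λ))` with `P`, `Q` nonsingular, `R(λ)` the regular part built
from `J` and a nilpotent `N`, and `S(λ)` the singular part with right minimal indices `m` and left
minimal indices `l`. The bijections `e`, `f` only number the rows and columns of the block matrix.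
`J` and `N` are not required to be Jordan matrices, so that the form exists over `ℝ` as well as over
`ℂ`; passing to their Jordan forms over `ℂ` is a similarity, which does not change
`det R(λ)`. -/
structure IsKroneckerForm (A B : Matrix (Fin n) (Fin n) 𝕜) {k r s : ℕ} (m l : Fin k → ℕ)
    (J : Matrix (Fin r) (Fin r) 𝕜) (N : Matrix (Fin s) (Fin s) 𝕜)
    (P Q : Matrix (Fin n) (Fin n) 𝕜)
    (e : (Fin r ⊕ Fin s) ⊕ ((Σ i, Fin (m i)) ⊕ (Σ i, Fin (l i + 1))) ≃ Fin n)
    (f : (Fin r ⊕ Fin s) ⊕ ((Σ i, Fin (m i + 1)) ⊕ (Σ i, Fin (l i))) ≃ Fin n) : Prop where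
  isUnit_left : IsUnit P
  isUnit_right : IsUnit Q
  isNilpotent : IsNilpotent N
  eq_blocks : (P.map C * pencil A B * Q.map C).submatrix e f =
    Matrix.fromBlocks (regularPart J N) 0 0 (singularPart 𝕜 m l)

/-- `z` is a simple finite eigenvalue of `A - λ B`: an eigenvalue that is a simple root of
`det R(λ)`, where `R(λ)` is the regular part of `A - λ B`. -/
def IsSimpleEigenvalue (A B : Matrix (Fin n) (Fin n) 𝕜) (z : 𝕜) : Prop :=
  IsEigenvalue A B z ∧
  ∃ (k r s : ℕ) (m l : Fin k → ℕ) (J : Matrix (Fin r) (Fin r) 𝕜) (N : Matrix (Fin s) (Fin s) 𝕜)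
    (P Q : Matrix (Fin n) (Fin n) 𝕜)
    (e : (Fin r ⊕ Fin s) ⊕ ((Σ i, Fin (m i)) ⊕ (Σ i, Fin (l i + 1))) ≃ Fin n)
    (f : (Fin r ⊕ Fin s) ⊕ ((Σ i, Fin (m i + 1)) ⊕ (Σ i, Fin (l i))) ≃ Fin n),
    IsKroneckerForm A B m l J N P Q e f ∧ (regularPart J N).det.rootMultiplicity z = 1

/-- `M` is a reducing subspace: `dim (A M + B M) = dim M - k`, where `k = n - nrank (A, B)`. -/
def IsReducing (A B : Matrix (Fin n) (Fin n) 𝕜) (M : Submodule 𝕜 (Fin n → 𝕜)) : Prop :=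
  Module.finrank 𝕜 (M.map A.mulVecLin ⊔ M.map B.mulVecLin : Submodule 𝕜 (Fin n → 𝕜)) + n =
    Module.finrank 𝕜 M + normalRank A B

/-- The minimal reducing subspace: the intersection of all reducing subspaces. The minimal left
reducing subspace of `A - λ B` is `minReducing Aᴴ Bᴴ`. -/
def minReducing (A B : Matrix (Fin n) (Fin n) 𝕜) : Submodule 𝕜 (Fin n → 𝕜) :=
  sInf {M | IsReducing A B M}

/-- `v` is a right eigenvector of `A - λ B` for `z`, normalized to have Euclidean norm one. -/
structure IsUnitRightEigenvector (A B : Matrix (Fin n) (Fin n) 𝕜) (z : 𝕜) (v : Fin n → 𝕜) :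
    Prop where
  norm_eq_one : star v ⬝ᵥ v = 1
  mulVec_eq_zero : (A - z • B).mulVec v = 0
  notMem_minReducing : v ∉ minReducing A B

/-- `w` is a left eigenvector of `A - λ B` for `z`, normalized to have Euclidean norm one. -/
structure IsUnitLeftEigenvector (A B : Matrix (Fin n) (Fin n) 𝕜) (z : 𝕜) (w : Fin n → 𝕜) :
    Prop where
  norm_eq_one : star w ⬝ᵥ w = 1
  vecMul_eq_zero : Matrix.vecMul (star w) (A - z • B) = 0
  notMem_minReducing : w ∉ minReducing A.conjTranspose B.conjTranspose

/-- The columns of the `n × (k + 1)` matrix `[X₁ x]` are orthonormal, those of `X₁` span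
`ker (A - z B) ∩ M_RS (A, B)`, and those of `[X₁ x]` span `ker (A - z B)`. -/
structure IsAdaptedKernelBasis {k : ℕ} (A B : Matrix (Fin n) (Fin n) 𝕜) (z : 𝕜)
    (X₁ : Matrix (Fin n) (Fin k) 𝕜) (x : Fin n → 𝕜) : Prop where
  orthonormal : (Matrix.fromCols X₁ (Matrix.replicateCol Unit x)).conjTranspose *
    Matrix.fromCols X₁ (Matrix.replicateCol Unit x) = 1
  span_left : Submodule.span 𝕜 (Set.range X₁.col) =
    (A - z • B).mulVecLin.ker ⊓ minReducing A B
  span_all : Submodule.span 𝕜 (insert x (Set.range X₁.col)) = (A - z • B).mulVecLin.ker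

end Pencils

section Random

variable {𝕜 : Type*} [RCLike 𝕜] [MeasurableSpace 𝕜] {n k : ℕ}

/-- `μ` is the uniform distribution on the Stiefel manifold `{Q ∈ 𝕜^{n × k} : Q* Q = I}`: the
probability measure carried by the manifold that is invariant under `Q ↦ W Q` for every orthogonal
(`𝕜 = ℝ`) or unitary (`𝕜 = ℂ`) `n × n` matrix `W`. This group is compact and acts transitively on
the manifold when `k ≤ n`, so there is exactly one such measure. -/
structure IsUniformStiefel (μ : Measure (Matrix (Fin n) (Fin k) 𝕜)) : Prop where
  isProbabilityMeasure : IsProbabilityMeasure μ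
  ae_mem : ∀ᵐ Q ∂μ, Q.conjTranspose * Q = 1
  invariant : ∀ W ∈ Matrix.unitaryGroup (Fin n) 𝕜, μ.map (fun Q => W * Q) = μ

/-- The matrix `M + τ U diag(d) V*`; with `M = A`, `d = d_A` and with `M = B`, `d = d_B` it gives
the two coefficients of the rank-completing modification of the pencil `A - λ B`. -/
def modified (M : Matrix (Fin n) (Fin n) 𝕜) (τ : 𝕜) (d : Fin k → 𝕜)
    (U V : Matrix (Fin n) (Fin k) 𝕜) : Matrix (Fin n) (Fin n) 𝕜 :=
  M + τ • (U * Matrix.diagonal d * V.conjTranspose)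

/-- The setting: `A - λ B` is an `n × n` pencil over `𝕜` of normal rank `n - k` with `k ≥ 1`, the
scalar `z` is a simple finite eigenvalue, `X = [X₁ x]` and `Y = [Y₁ y]` are adapted orthonormal
bases of `ker (A - z B)` and `ker (A - z B)*`, the modification has `τ ≠ 0` and diagonal matrices
`diag(dA)`, `diag(dB)` whose pencil does not have the eigenvalue `z`, `U` and `V` are uniform on the
Stiefel manifold, and `xi`, `yi` are unit right and left eigenvectors for `z` of the modified pencil
whenever that pencil is regular. -/
structure Setting {Ω : Type*} [MeasurableSpace Ω] (P : Measure Ω)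
    (A B : Matrix (Fin n) (Fin n) 𝕜) (z : 𝕜)
    (X₁ : Matrix (Fin n) (Fin k) 𝕜) (x : Fin n → 𝕜)
    (Y₁ : Matrix (Fin n) (Fin k) 𝕜) (y : Fin n → 𝕜)
    (τ : 𝕜) (dA dB : Fin k → 𝕜) (U V : Ω → Matrix (Fin n) (Fin k) 𝕜)
    (xi yi : Ω → Fin n → 𝕜) : Prop where
  one_le : 1 ≤ k
  normalRank_add : normalRank A B + k = n
  simple : IsSimpleEigenvalue A B z
  basis_right : IsAdaptedKernelBasis A B z X₁ x
  basis_left : IsAdaptedKernelBasis A.conjTranspose B.conjTranspose (star z) Y₁ y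
  tau_ne_zero : τ ≠ 0
  not_prescribed : ∀ j, dA j - z * dB j ≠ 0
  measurable_U : Measurable U
  measurable_V : Measurable V
  uniform_U : IsUniformStiefel (P.map U)
  uniform_V : IsUniformStiefel (P.map V)
  eigenvector_right : ∀ᵐ ω ∂P,
    IsRegularPencil (modified A τ dA (U ω) (V ω)) (modified B τ dB (U ω) (V ω)) →
      IsUnitRightEigenvector (modified A τ dA (U ω) (V ω)) (modified B τ dB (U ω) (V ω)) z (xi ω)
  eigenvector_left : ∀ᵐ ω ∂P,
    IsRegularPencil (modified A τ dA (U ω) (V ω)) (modified B τ dB (U ω) (V ω)) →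
      IsUnitLeftEigenvector (modified A τ dA (U ω) (V ω)) (modified B τ dB (U ω) (V ω)) z (yi ω)

/-- The component of `v` along the unit vector `x`. If `v = X₁ a + α x` and the columns of `[X₁ x]`
are orthonormal, it is `α`. -/
def component (x v : Fin n → 𝕜) : 𝕜 := star x ⬝ᵥ v

end Random

end SingularPencil

/-! Write `M = A - z • B`, and let `X = [X₁ x]`. At `z` the perturbed pencil equals `M + U D Vᴴ`
with `D` diagonal and invertible. Multiplying an eigenvector equation by `Y₁ᴴ` kills `M`, and `Y₁ᴴ
U` is almost surely invertible, so every right eigenvector `v` satisfies `Vᴴ v = 0` and `M v = 0`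
(`mulVec_eq_zero_of_completion`). Hence `v = X c` with `c` a unit vector orthogonal to the columns
of `Z = Xᴴ V`. The law of `Z` is unitarily invariant on `(k + 1) × k` matrices and `Z` almost surely
has full rank, so `c` is the unit normal of a random hyperplane in general position, and `α` is one
coordinate of `c`. The left eigenvector is treated in the same way, with `U` and `V` exchanged.

No uniform law on a sphere or Haar measure on a group is needed. By
`measure_mul_measure_univ_le_lintegral`, an event invariant under simultaneous unitary motion of
`(Z, g)` may be estimated by freezing `Z` and randomizing `g`. Taking `g` uniform in the Euclidean
ball reduces everything to the volume of a double cone, that is, to the law of the slope `z / |y|`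
for `(y, z)` in `𝕜 ^ k × 𝕜` (`prod_setOf_slope_mem`). Over `ℂ` the probability that the component is
at most `s` is `1 - (1 - s²) ^ k ≤ k s²`; over `ℝ` it is a ratio of integrals of `cos ^ (k - 1)`, at
most `s √(2k/π)` when `s² ≤ 1/2`.

Finally, `|α||β| < t` forces `|α| ≤ √t` or `|β| ≤ √t`. The union bound, which needs no independence,
doubles the one-sided estimate at `s = √t`. -/

namespace SingularPencil

open Matrix ENNReal
open scoped ComplexOrder

/-! ### Transitivity of the unitary group on column spaces -/

section Unitary

lemma exists_linearIsometry_mapsTo_of_finrank_eq {𝕜 E : Type*} [RCLike 𝕜]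
    [NormedAddCommGroup E] [InnerProductSpace 𝕜 E] [FiniteDimensional 𝕜 E] {S S' : Submodule 𝕜 E}
    (h : Module.finrank 𝕜 S = Module.finrank 𝕜 S') :
    ∃ L : E →ₗᵢ[𝕜] E, ∀ s ∈ S, L s ∈ S' := by
  let φ := (stdOrthonormalBasis 𝕜 S).equiv (stdOrthonormalBasis 𝕜 S') (finCongr h)
  refine ⟨(S'.subtypeₗᵢ.comp φ.toLinearIsometry).extend, fun s hs => ?_⟩
  rw [LinearIsometry.extend_apply _ ⟨s, hs⟩]
  exact (φ ⟨s, hs⟩).2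

variable {𝕜 : Type*} [RCLike 𝕜] {ι m : Type*} [Fintype ι] [Fintype m] [DecidableEq m]

lemma mulVec_injective_of_det_gram_ne_zero {G : Matrix ι m 𝕜} (hG : (Gᴴ * G).det ≠ 0) :
    Function.Injective G.mulVec := by
  have h : Function.Injective (Gᴴ * G).mulVec :=
    Matrix.mulVec_injective_iff_isUnit.2 ((Matrix.isUnit_iff_isUnit_det _).2 hG.isUnit)
  intro v w hvw
  apply h
  simp only [← Matrix.mulVec_mulVec, hvw]

/-- The unitary group acts transitively on the column spaces of matrices of full column rank. -/
lemma exists_unitary_mul_eq [DecidableEq ι] {G G' : Matrix ι m 𝕜} (hG : (Gᴴ * G).det ≠ 0)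
    (hG' : (G'ᴴ * G').det ≠ 0) :
    ∃ W ∈ Matrix.unitaryGroup ι 𝕜, ∃ R : Matrix m m 𝕜, R.det ≠ 0 ∧ W * G = G' * R := by
  classical
  obtain ⟨T, hTv⟩ : ∃ T : Matrix ι m 𝕜 → (EuclideanSpace 𝕜 m →ₗ[𝕜] EuclideanSpace 𝕜 ι),
      ∀ M v, T M v = WithLp.toLp 2 (M.mulVec (WithLp.ofLp v)) :=
    ⟨fun M => Matrix.toEuclideanLin M, fun M v => Matrix.toLpLin_apply _ _ _ _⟩
  have hT : ∀ M : Matrix ι m 𝕜, (Mᴴ * M).det ≠ 0 → Function.Injective (T M) := by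
    intro M hM v w hvw
    have := mulVec_injective_of_det_gram_ne_zero hM
      (a₁ := WithLp.ofLp v) (a₂ := WithLp.ofLp w) (by
        have := congrArg WithLp.ofLp hvw
        simpa [hTv] using this)
    exact WithLp.ofLp_injective _ this
  have hfr : Module.finrank 𝕜 (LinearMap.range (T G)) =
      Module.finrank 𝕜 (LinearMap.range (T G')) := by
    rw [LinearMap.finrank_range_of_inj (hT G hG), LinearMap.finrank_range_of_inj (hT G' hG')]
  obtain ⟨L, hL⟩ := exists_linearIsometry_mapsTo_of_finrank_eq hfr
  obtain ⟨W, hWL⟩ : ∃ W : Matrix ι ι 𝕜,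
      ∀ v, WithLp.toLp 2 (W.mulVec v) = L (WithLp.toLp 2 v) := by
    refine ⟨Matrix.toEuclideanLin.symm L.toLinearMap, fun v => ?_⟩
    have h : Matrix.toEuclideanLin (Matrix.toEuclideanLin.symm L.toLinearMap) = L.toLinearMap :=
      LinearEquiv.apply_symm_apply _ _
    have := LinearMap.congr_fun h (WithLp.toLp 2 v)
    rwa [Matrix.toLpLin_apply] at this
  have hW : Wᴴ * W = 1 := by
    ext i j
    have h := L.inner_map_map (WithLp.toLp 2 (Pi.single i 1)) (WithLp.toLp 2 (Pi.single j 1))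
    rw [← hWL, ← hWL, EuclideanSpace.inner_toLp_toLp, EuclideanSpace.inner_toLp_toLp] at h
    simp only [Matrix.mulVec_single_one, dotProduct, Matrix.col_apply, Pi.star_apply] at h
    rw [Matrix.mul_apply, Finset.sum_congr rfl fun x _ => mul_comm _ _]
    simp only [Matrix.conjTranspose_apply, h]
    simp [Matrix.one_apply, Pi.single_apply, eq_comm]
  have hcol : ∀ j, ∃ r : m → 𝕜, W.mulVec (G.col j) = G'.mulVec r := by
    intro j
    have hmem : WithLp.toLp 2 (G.col j) ∈ LinearMap.range (T G) :=
      ⟨WithLp.toLp 2 (Pi.single j 1), by simp [hTv]⟩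
    obtain ⟨r, hr⟩ := hL _ hmem
    refine ⟨WithLp.ofLp r, ?_⟩
    rw [← hWL] at hr
    simpa [hTv] using (congrArg WithLp.ofLp hr).symm
  choose r hr using hcol
  have hR : W * G = G' * Matrix.of fun i j => r j i := by
    ext i j
    exact congrFun (hr j) i
  -- `R` is invertible because the Gram matrix of `G` equals `(W G)ᴴ G' R`, so `det R = 0` would
  -- make it singular.
  refine ⟨W, Matrix.mem_unitaryGroup_iff'.2 hW, Matrix.of fun i j => r j i, fun h0 => ?_, hR⟩
  have h2 : Gᴴ * G = (W * G)ᴴ * (W * G) := by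
    rw [Matrix.conjTranspose_mul, Matrix.mul_assoc, ← Matrix.mul_assoc Wᴴ, hW, Matrix.one_mul]
  apply hG
  rw [h2]
  nth_rw 2 [hR]
  rw [← Matrix.mul_assoc, Matrix.det_mul, h0, mul_zero]

end Unitary

/-! ### Averaging over the second argument of an invariant event -/

section Averaging

/-- Left multiplication by a matrix is measurable. -/
lemma measurable_matrix_mul_left {𝕜 : Type*} [RCLike 𝕜] [MeasurableSpace 𝕜] [BorelSpace 𝕜]
    {ι m l : Type*} [Fintype m] (W : Matrix ι m 𝕜) :
    Measurable fun Q : Matrix m l 𝕜 => W * Q := by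
  refine measurable_pi_lambda _ fun i => measurable_pi_lambda _ fun j => ?_
  simp only [Matrix.mul_apply]
  exact Finset.measurable_sum _ fun a _ => Measurable.const_mul
    ((measurable_pi_apply j).comp (measurable_pi_apply (X := fun _ => l → 𝕜) a)) _

variable {𝕜 : Type*} [RCLike 𝕜] [MeasurableSpace 𝕜] [BorelSpace 𝕜] {ι m l : Type*} [Fintype ι]
  [DecidableEq ι] [Fintype m] [DecidableEq m]

/-- If an event about a random matrix `V`, whose law is invariant under unitary matrices, and a
full rank matrix `G` depends on `G` only through its column space, and is invariant
under the simultaneous action of unitary matrices, then its probability can be computed by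
averaging over `G`. -/
lemma measure_mul_measure_univ_le_lintegral {κ : Measure (Matrix ι l 𝕜)} [IsProbabilityMeasure κ]
    (hκ : ∀ W ∈ Matrix.unitaryGroup ι 𝕜, κ.map (fun Q => W * Q) = κ)
    {E : Set (Matrix ι l 𝕜 × Matrix ι m 𝕜)} (hE : MeasurableSet E)
    (hEW : ∀ W ∈ Matrix.unitaryGroup ι 𝕜, ∀ V G, (V, G) ∈ E → (W * V, W * G) ∈ E)
    (hER : ∀ R : Matrix m m 𝕜, R.det ≠ 0 → ∀ V G, (V, G) ∈ E → (V, G * R) ∈ E)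
    {γ : Measure (Matrix ι m 𝕜)} [SFinite γ] (hγ : ∀ᵐ G ∂γ, (Gᴴ * G).det ≠ 0)
    {G₀ : Matrix ι m 𝕜} (hG₀ : (G₀ᴴ * G₀).det ≠ 0) :
    κ {V | (V, G₀) ∈ E} * γ Set.univ ≤ ∫⁻ V, γ {G | (V, G) ∈ E} ∂κ := by
  -- Move `G₀` onto the column space of `G` by a unitary `W`; the law of `V` does not notice `W`.
  -- The rest is Tonelli.
  have key : ∀ᵐ G ∂γ, κ {V | (V, G₀) ∈ E} ≤ κ {V | (V, G) ∈ E} := by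
    filter_upwards [hγ] with G hG
    obtain ⟨W, hW, R, hR, h⟩ := exists_unitary_mul_eq hG₀ hG
    calc κ {V | (V, G₀) ∈ E} ≤ κ ((fun Q => W * Q) ⁻¹' {V | (V, G) ∈ E}) := by
          refine measure_mono fun V hV => ?_
          have h1 := hEW W hW V G₀ hV
          rw [h] at h1
          have h2 := hER R⁻¹ (by
            rw [Matrix.det_nonsing_inv]; simpa using hR) _ _ h1
          rwa [Matrix.mul_assoc, Matrix.mul_nonsing_inv _ hR.isUnit, Matrix.mul_one] at h2
      _ = κ {V | (V, G) ∈ E} := by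
          have hm : MeasurableSet {V | (V, G) ∈ E} := measurable_prodMk_right hE
          rw [← Measure.map_apply (measurable_matrix_mul_left W) hm, hκ W hW]
  calc κ {V | (V, G₀) ∈ E} * γ Set.univ = ∫⁻ _, κ {V | (V, G₀) ∈ E} ∂γ := by
        rw [lintegral_const]
    _ ≤ ∫⁻ G, κ {V | (V, G) ∈ E} ∂γ := lintegral_mono_ae key
    _ = (κ.prod γ) E := (Measure.prod_apply_symm hE).symm
    _ = ∫⁻ V, γ {G | (V, G) ∈ E} ∂κ := Measure.prod_apply hE

end Averaging

/-! ### General position of a uniform random subspace -/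

section Rank

instance instBorelSpaceMatrix {𝕜 m n : Type*} [RCLike 𝕜] [MeasurableSpace 𝕜] [BorelSpace 𝕜]
    [Fintype m] [Fintype n] : BorelSpace (Matrix m n 𝕜) :=
  inferInstanceAs (BorelSpace (m → n → 𝕜))

instance instSecondCountableTopologyMatrix {𝕜 m n : Type*} [RCLike 𝕜]
    [Fintype m] [Fintype n] : SecondCountableTopology (Matrix m n 𝕜) :=
  inferInstanceAs (SecondCountableTopology (m → n → 𝕜))

/-- A measurable set meeting all lines in a given direction in a null set is null. -/
lemma measure_eq_zero_of_forall_line {E : Type*} [AddCommGroup E] [Module ℝ E] [MeasurableSpace E]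
    [MeasurableAdd₂ E] [MeasurableSMul ℝ E] {γ : Measure E} [SFinite γ] [γ.IsAddRightInvariant]
    {Z : Set E} (hZ : MeasurableSet Z) (v : E)
    (h : ∀ g, volume {t : ℝ | g + t • v ∈ Z} = 0) : γ Z = 0 := by
  have hS : MeasurableSet {p : ℝ × E | p.2 + p.1 • v ∈ Z} := by
    have : Measurable fun p : ℝ × E => p.2 + p.1 • v :=
      measurable_snd.add (measurable_fst.smul_const v)
    exact this hZ
  have h1 := Measure.prod_apply (μ := volume.restrict (Set.Icc (0 : ℝ) 1)) (ν := γ) hS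
  have h2 := Measure.prod_apply_symm (μ := volume.restrict (Set.Icc (0 : ℝ) 1)) (ν := γ) hS
  have h3 : ∀ t : ℝ, γ (Prod.mk t ⁻¹' {p : ℝ × E | p.2 + p.1 • v ∈ Z}) = γ Z := fun t =>
    measure_preimage_add_right γ (t • v) Z
  have h4 : ∀ g : E, (volume.restrict (Set.Icc (0 : ℝ) 1))
      ((fun t => (t, g)) ⁻¹' {p : ℝ × E | p.2 + p.1 • v ∈ Z}) = 0 := fun g =>
    le_antisymm ((Measure.restrict_apply_le _ _).trans (h g).le) bot_le
  simp only [h3, h4, lintegral_const] at h1 h2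
  simpa [h2] using h1.symm

lemma det_gram_ne_zero_of_det_mul_ne_zero {𝕜 ι m : Type*} [RCLike 𝕜] [Fintype ι] [Fintype m]
    [DecidableEq m] {G V : Matrix ι m 𝕜} (h : (Gᴴ * V).det ≠ 0) :
    (Vᴴ * V).det ≠ 0 := by
  rw [← isUnit_iff_ne_zero, ← Matrix.isUnit_iff_isUnit_det, ← Matrix.mulVec_injective_iff_isUnit,
    ← Matrix.coe_mulVecLin, ← LinearMap.ker_eq_bot, Matrix.ker_mulVecLin_conjTranspose_mul_self,
    LinearMap.ker_eq_bot, Matrix.coe_mulVecLin]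
  have h' : Function.Injective (Gᴴ * V).mulVec :=
    Matrix.mulVec_injective_iff_isUnit.2 ((Matrix.isUnit_iff_isUnit_det _).2 h.isUnit)
  intro v w hvw
  apply h'
  simp only [← Matrix.mulVec_mulVec, hvw]

variable {𝕜 : Type*} [RCLike 𝕜] [MeasurableSpace 𝕜] [BorelSpace 𝕜] {ι m : Type*} [Fintype ι]
  [Fintype m] [DecidableEq m]

/-- Along the line `G + t V` the determinant is `det (Gᴴ V + t)`, the characteristic polynomial of
`-Gᴴ V` at `t`. It is monic, so each such line meets the zero set in finitely many points. -/
lemma addHaar_setOf_det_eq_zero {V : Matrix ι m 𝕜} (hV : Vᴴ * V = 1) :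
    (Measure.addHaar : Measure (ι → m → 𝕜)) {G | ((Matrix.of G)ᴴ * V).det = 0} = 0 := by
  have hZ : MeasurableSet {G : ι → m → 𝕜 | ((Matrix.of G)ᴴ * V).det = 0} := by
    apply IsClosed.measurableSet
    refine isClosed_eq ?_ continuous_const
    refine Continuous.matrix_det (Continuous.matrix_mul ?_ continuous_const)
    exact Continuous.matrix_conjTranspose continuous_id
  refine measure_eq_zero_of_forall_line hZ (fun i j => V i j) fun G => ?_
  have h : {t : ℝ | G + t • (fun i j => V i j) ∈
      {G : ι → m → 𝕜 | ((Matrix.of G)ᴴ * V).det = 0}} ⊆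
      (RCLike.ofReal : ℝ → 𝕜) ⁻¹' {s | (-((Matrix.of G)ᴴ * V)).charpoly.IsRoot s} := by
    intro t ht
    simp only [Set.mem_ofPred_eq, Set.mem_preimage, Polynomial.IsRoot.def,
      Matrix.eval_charpoly] at ht ⊢
    rw [← ht, sub_neg_eq_add]
    congr 1
    have : (Matrix.of (G + t • (fun i j => V i j)) : Matrix ι m 𝕜) = Matrix.of G + (t : 𝕜) • V := by
      ext i j
      simp [RCLike.real_smul_eq_coe_mul]
    rw [this, Matrix.conjTranspose_add, Matrix.conjTranspose_smul, Matrix.add_mul,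
      Matrix.smul_mul, hV, add_comm]
    ext i j
    simp [Matrix.one_apply, Matrix.diagonal_apply, RCLike.real_smul_eq_coe_mul]
  refine Set.Finite.measure_zero (Set.Finite.subset (Set.Finite.preimage ?_ ?_) h) _
  · exact RCLike.ofReal_injective.injOn
  · exact Polynomial.finite_setOfPred_isRoot (Matrix.charpoly_monic _).ne_zero

/-- A uniformly distributed random subspace is almost surely in general position with respect to
a fixed one. -/
lemma ae_det_conjTranspose_mul_ne_zero [DecidableEq ι] {κ : Measure (Matrix ι m 𝕜)}
    [IsProbabilityMeasure κ]
    (hκ : ∀ W ∈ Matrix.unitaryGroup ι 𝕜, κ.map (fun Q => W * Q) = κ)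
    (hκ1 : ∀ᵐ V ∂κ, Vᴴ * V = 1) {G₀ : Matrix ι m 𝕜} (hG₀ : (G₀ᴴ * G₀).det ≠ 0) :
    ∀ᵐ V ∂κ, (G₀ᴴ * V).det ≠ 0 := by
  let γ : Measure (Matrix ι m 𝕜) := (Measure.addHaar : Measure (ι → m → 𝕜))
  have : SFinite γ := inferInstanceAs (SFinite (Measure.addHaar : Measure (ι → m → 𝕜)))
  have hγ0 : ∀ V : Matrix ι m 𝕜, Vᴴ * V = 1 → γ {G | (Gᴴ * V).det = 0} = 0 := fun V hV =>
    addHaar_setOf_det_eq_zero hV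
  obtain ⟨V₁, hV₁⟩ := hκ1.exists
  have hγ : ∀ᵐ G ∂γ, (Gᴴ * G).det ≠ 0 := by
    have : ∀ᵐ G ∂γ, (Gᴴ * V₁).det ≠ 0 := by
      rw [ae_iff]; simpa using hγ0 V₁ hV₁
    filter_upwards [this] with G hG
    apply det_gram_ne_zero_of_det_mul_ne_zero (G := V₁)
    intro h0
    apply hG
    rw [← Matrix.conjTranspose_conjTranspose V₁, ← Matrix.conjTranspose_mul,
      Matrix.det_conjTranspose, h0, star_zero]
  have hE : MeasurableSet {p : Matrix ι m 𝕜 × Matrix ι m 𝕜 | (p.2ᴴ * p.1).det = 0} := by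
    apply IsClosed.measurableSet
    refine isClosed_eq ?_ continuous_const
    exact Continuous.matrix_det (Continuous.matrix_mul
      (Continuous.matrix_conjTranspose continuous_snd) continuous_fst)
  have h := measure_mul_measure_univ_le_lintegral hκ hE (fun W hW V G h => by
      simp only [Set.mem_ofPred_eq] at h ⊢
      rw [Matrix.conjTranspose_mul, Matrix.mul_assoc, ← Matrix.mul_assoc Wᴴ]
      have := Matrix.mem_unitaryGroup_iff'.1 hW
      rw [Matrix.star_eq_conjTranspose] at this
      rwa [this, Matrix.one_mul]) (fun R _ V G h => by
      simp only [Set.mem_ofPred_eq] at h ⊢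
      rw [Matrix.conjTranspose_mul, Matrix.mul_assoc, Matrix.det_mul, h, mul_zero]) hγ hG₀
  have h0 : ∫⁻ V, γ {G | (V, G) ∈ {p : Matrix ι m 𝕜 × Matrix ι m 𝕜 | (p.2ᴴ * p.1).det = 0}} ∂κ
      = 0 := by
    rw [lintegral_eq_zero_of_ae_eq_zero]
    filter_upwards [hκ1] with V hV using hγ0 V hV
  -- Only the nonvanishing of the total mass of `γ` matters; it may be infinite.
  rw [h0, nonpos_iff_eq_zero, mul_eq_zero] at h
  rw [ae_iff]
  rcases h with h | h
  · simpa using h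
  · exact absurd h (by
      rw [Measure.measure_univ_eq_zero]
      exact NeZero.ne (Measure.addHaar : Measure (ι → m → 𝕜)))

end Rank

/-! ### The unit normal of a random hyperplane -/

section Kernel

variable {𝕜 : Type*} [RCLike 𝕜]

lemma star_dotProduct_self {ι : Type*} [Fintype ι] (c : ι → 𝕜) :
    star c ⬝ᵥ c = ((∑ i, ‖c i‖ ^ 2 : ℝ) : 𝕜) := by
  simp [dotProduct, RCLike.conj_mul]

lemma star_dotProduct_self_eq_one_iff {ι : Type*} [Fintype ι] {c : ι → 𝕜} :
    star c ⬝ᵥ c = 1 ↔ ∑ i, ‖c i‖ ^ 2 = 1 := by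
  rw [star_dotProduct_self]
  norm_cast

lemma isCompact_setOf_star_dotProduct_self_eq_one {ι : Type*} [Fintype ι] :
    IsCompact {c : ι → 𝕜 | star c ⬝ᵥ c = 1} := by
  refine Metric.isCompact_of_isClosed_isBounded ?_ ?_
  · exact isClosed_eq (Continuous.dotProduct continuous_star continuous_id) continuous_const
  · refine (Metric.isBounded_closedBall (x := (0 : ι → 𝕜)) (r := 1)).subset fun c hc => ?_
    rw [mem_closedBall_zero_iff, pi_norm_le_iff_of_nonneg zero_le_one]
    intro i
    have h : ∑ i, ‖c i‖ ^ 2 = 1 := star_dotProduct_self_eq_one_iff.1 hc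
    have h1 : ‖c i‖ ^ 2 ≤ ∑ i, ‖c i‖ ^ 2 :=
      Finset.single_le_sum (f := fun i => ‖c i‖ ^ 2) (fun _ _ => sq_nonneg _) (Finset.mem_univ i)
    rw [h] at h1
    exact (sq_le_one_iff₀ (norm_nonneg _)).1 h1

variable {m : Type*} [Fintype m]

/-- The kernel of the adjoint of a full rank matrix with one more row than columns is a line. -/
lemma exists_unit_forall_norm_eq {Z : Matrix (m ⊕ Unit) m 𝕜} (hZ : Function.Injective Z.mulVec) :
    ∃ c₀ : m ⊕ Unit → 𝕜, star c₀ ⬝ᵥ c₀ = 1 ∧ ∀ c, star c ⬝ᵥ c = 1 → Zᴴ *ᵥ c = 0 →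
      ∀ g, ‖star c ⬝ᵥ g‖ = ‖star c₀ ⬝ᵥ g‖ := by
  have hrank : Zᴴ.rank = Fintype.card m := by
    rw [Matrix.rank_conjTranspose, Matrix.rank, LinearMap.finrank_range_of_inj hZ,
      Module.finrank_pi]
  have hker : Module.finrank 𝕜 (LinearMap.ker Zᴴ.mulVecLin) = 1 := by
    have h := LinearMap.finrank_range_add_finrank_ker Zᴴ.mulVecLin
    rw [← Matrix.rank, hrank, Module.finrank_pi, Fintype.card_sum, Fintype.card_unit] at h
    omega
  obtain ⟨⟨w, hw⟩, hw0, hspan⟩ := finrank_eq_one_iff'.1 hker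
  have hw0' : w ≠ 0 := fun h => hw0 (Subtype.ext h)
  have hpos : 0 < ∑ i, ‖w i‖ ^ 2 := by
    obtain ⟨i, hi⟩ := Function.ne_iff.1 hw0'
    exact Finset.sum_pos' (fun _ _ => sq_nonneg _) ⟨i, Finset.mem_univ i, by
      have : 0 < ‖w i‖ := norm_pos_iff.2 hi
      positivity⟩
  set r : ℝ := Real.sqrt (∑ i, ‖w i‖ ^ 2) with hr
  have hr0 : 0 < r := Real.sqrt_pos.2 hpos
  have hr2 : r ^ 2 = ∑ i, ‖w i‖ ^ 2 := Real.sq_sqrt hpos.le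
  have hnorm : ∀ a : 𝕜, ∑ i, ‖(a • w) i‖ ^ 2 = ‖a‖ ^ 2 * r ^ 2 := by
    intro a
    simp only [Pi.smul_apply, norm_smul, mul_pow, ← Finset.mul_sum, hr2]
  refine ⟨((r⁻¹ : ℝ) : 𝕜) • w, ?_, ?_⟩
  · rw [star_dotProduct_self_eq_one_iff, hnorm, RCLike.norm_ofReal, sq_abs, ← mul_pow,
      inv_mul_cancel₀ hr0.ne', one_pow]
  · intro c hc hZc g
    obtain ⟨a, ha⟩ := hspan ⟨c, by simpa using hZc⟩
    have ha' : c = a • w := (congrArg Subtype.val ha).symm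
    subst ha'
    rw [star_dotProduct_self_eq_one_iff, hnorm, ← mul_pow] at hc
    have h1 : ‖a‖ * r = 1 := (pow_eq_one_iff_of_nonneg (by positivity) two_ne_zero).1 hc
    have h2 : ‖a‖ = r⁻¹ := eq_inv_of_mul_eq_one_left h1
    rw [star_smul, star_smul, smul_dotProduct, smul_dotProduct, norm_smul, norm_smul, norm_star,
      norm_star, h2, RCLike.norm_ofReal, abs_of_pos (inv_pos.2 hr0)]

/-- `p` bounds the probability that the component of a random vector of law `γ` along a
fixed direction is at most `s` times its length. -/
structure IsComponentBound {ι : Type*} [Fintype ι] [MeasurableSpace 𝕜] (γ : Measure (ι → 𝕜))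
    (s : ℝ) (p : ℝ≥0∞) : Prop where
  isProbabilityMeasure : IsProbabilityMeasure γ
  singleton_zero : γ {0} = 0
  le : ∀ c : ι → 𝕜, star c ⬝ᵥ c = 1 →
    γ {g | ‖star c ⬝ᵥ g‖ ^ 2 ≤ s ^ 2 * ∑ i, ‖g i‖ ^ 2} ≤ p

variable [MeasurableSpace 𝕜] [BorelSpace 𝕜] [DecidableEq m]

/-- Almost surely the kernel of `Zᴴ` is a line, so the normal `c` is unique up to a phase. The fixed
coordinate axis is replaced by a random `g` of law `γ`, after which `c` is fixed and
`IsComponentBound` applies. Quantifying over all `c` avoids choosing a normal. -/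
lemma measure_exists_kernel_vector_le {κ : Measure (Matrix (m ⊕ Unit) m 𝕜)}
    [IsProbabilityMeasure κ]
    (hκ : ∀ W ∈ Matrix.unitaryGroup (m ⊕ Unit) 𝕜, κ.map (fun Q => W * Q) = κ)
    (hκ1 : ∀ᵐ Z ∂κ, Function.Injective Z.mulVec)
    {γ : Measure (m ⊕ Unit → 𝕜)} {s : ℝ} {p : ℝ≥0∞} (hγ : IsComponentBound γ s p) :
    κ {Z | ∃ c, star c ⬝ᵥ c = 1 ∧ Zᴴ *ᵥ c = 0 ∧ ‖c (Sum.inr ())‖ ^ 2 ≤ s ^ 2} ≤ p := by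
  have := hγ.isProbabilityMeasure
  let S : Set (m ⊕ Unit → 𝕜) := {c | star c ⬝ᵥ c = 1}
  have : CompactSpace S := isCompact_iff_compactSpace.1 isCompact_setOf_star_dotProduct_self_eq_one
  let E : Set (Matrix (m ⊕ Unit) m 𝕜 × Matrix (m ⊕ Unit) Unit 𝕜) :=
    {q | ∃ c, star c ⬝ᵥ c = 1 ∧ q.1ᴴ *ᵥ c = 0 ∧
      ‖star c ⬝ᵥ (fun i => q.2 i ())‖ ^ 2 ≤ s ^ 2 * ∑ i, ‖q.2 i ()‖ ^ 2}
  have hsum : ∀ G : Matrix (m ⊕ Unit) Unit 𝕜,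
      ((∑ i, ‖G i ()‖ ^ 2 : ℝ) : 𝕜) = (Gᴴ * G) () () := by
    intro G
    simp [Matrix.mul_apply, RCLike.conj_mul]
  -- `E` is the projection of a closed set along the compact unit sphere of vectors `c`, hence
  -- closed.
  have hE : MeasurableSet E := by
    have hc : IsClosed {q : S × (Matrix (m ⊕ Unit) m 𝕜 × Matrix (m ⊕ Unit) Unit 𝕜) |
        q.2.1ᴴ *ᵥ (q.1 : m ⊕ Unit → 𝕜) = 0 ∧ ‖star (q.1 : m ⊕ Unit → 𝕜) ⬝ᵥ
          (fun i => q.2.2 i ())‖ ^ 2 ≤ s ^ 2 * ∑ i, ‖q.2.2 i ()‖ ^ 2} := by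
      have hent : ∀ i, Continuous fun q : S × (Matrix (m ⊕ Unit) m 𝕜 × Matrix (m ⊕ Unit) Unit 𝕜) =>
          q.2.2 i () := fun i =>
        Continuous.matrix_elem (continuous_snd.comp continuous_snd) i ()
      have hval : Continuous fun q : S × (Matrix (m ⊕ Unit) m 𝕜 × Matrix (m ⊕ Unit) Unit 𝕜) =>
          (q.1 : m ⊕ Unit → 𝕜) := continuous_subtype_val.comp continuous_fst
      refine (isClosed_eq ?_ continuous_const).and (isClosed_le ?_ ?_)
      · exact Continuous.matrix_mulVec (Continuous.matrix_conjTranspose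
          (continuous_fst.comp continuous_snd)) hval
      · exact ((Continuous.dotProduct hval.star (continuous_pi hent)).norm).pow 2
      · exact continuous_const.mul (continuous_finsetSum _ fun i _ => (hent i).norm.pow 2)
    have hEq : E = Prod.snd '' {q : S × (Matrix (m ⊕ Unit) m 𝕜 × Matrix (m ⊕ Unit) Unit 𝕜) |
        q.2.1ᴴ *ᵥ (q.1 : m ⊕ Unit → 𝕜) = 0 ∧ ‖star (q.1 : m ⊕ Unit → 𝕜) ⬝ᵥ
          (fun i => q.2.2 i ())‖ ^ 2 ≤ s ^ 2 * ∑ i, ‖q.2.2 i ()‖ ^ 2} := by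
      ext q
      constructor
      · rintro ⟨c, hc, h1, h2⟩
        exact ⟨(⟨c, hc⟩, q), ⟨h1, h2⟩, rfl⟩
      · rintro ⟨⟨c, q'⟩, ⟨h1, h2⟩, rfl⟩
        exact ⟨c, c.2, h1, h2⟩
    rw [hEq]
    exact (isClosedMap_snd_of_compactSpace _ hc).measurableSet
  have hrep : Measurable (Matrix.replicateCol Unit : (m ⊕ Unit → 𝕜) → Matrix (m ⊕ Unit) Unit 𝕜) :=
    measurable_pi_lambda _ fun i => measurable_pi_lambda _ fun _ => measurable_pi_apply i
  have hdet : ∀ G : Matrix (m ⊕ Unit) Unit 𝕜,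
      (Gᴴ * G).det = ((∑ i, ‖G i ()‖ ^ 2 : ℝ) : 𝕜) := by
    intro G
    rw [hsum, Matrix.det_unique]
  have hprob : IsProbabilityMeasure (γ.map (Matrix.replicateCol Unit)) :=
    Measure.isProbabilityMeasure_map hrep.aemeasurable
  have h := measure_mul_measure_univ_le_lintegral (γ := γ.map (Matrix.replicateCol Unit))
    (G₀ := Matrix.replicateCol Unit (Pi.single (Sum.inr ()) 1)) hκ hE ?_ ?_ ?_ ?_
  · rw [measure_univ, mul_one] at h
    calc _ ≤ κ {V | (V, Matrix.replicateCol Unit (Pi.single (Sum.inr ()) 1)) ∈ E} := by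
          refine measure_mono ?_
          rintro Z ⟨c, hc, hZ, hs⟩
          refine ⟨c, hc, hZ, ?_⟩
          simpa [Pi.single_apply, dotProduct, Fintype.sum_sum_type, apply_ite norm, ite_pow] using hs
      _ ≤ _ := h
      _ ≤ ∫⁻ _, p ∂κ := by
          refine lintegral_mono_ae ?_
          filter_upwards [hκ1] with Z hZ
          obtain ⟨c₀, hc₀, hall⟩ := exists_unit_forall_norm_eq hZ
          have hm : MeasurableSet {G | (Z, G) ∈ E} := measurable_prodMk_left hE
          rw [Measure.map_apply hrep hm]
          refine (measure_mono ?_).trans (hγ.le c₀ hc₀)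
          rintro g ⟨c, hc, hZc, hle⟩
          rw [hall c hc hZc] at hle
          exact hle
      _ = p := by simp
  · rintro W hW V G ⟨c, hc, hV, hle⟩
    have hW' : Wᴴ * W = 1 := Matrix.mem_unitaryGroup_iff'.1 hW
    refine ⟨W *ᵥ c, ?_, ?_, ?_⟩
    · rw [Matrix.star_mulVec, ← Matrix.dotProduct_mulVec, Matrix.mulVec_mulVec, hW',
        Matrix.one_mulVec, hc]
    · rw [Matrix.conjTranspose_mul, Matrix.mulVec_mulVec, Matrix.mul_assoc, hW', Matrix.mul_one, hV]
    · have h1 : (fun i => (W * G) i ()) = W *ᵥ fun i => G i () := rfl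
      have h2 : ∑ i, ‖(W * G) i ()‖ ^ 2 = ∑ i, ‖G i ()‖ ^ 2 := by
        have : ((∑ i, ‖(W * G) i ()‖ ^ 2 : ℝ) : 𝕜) = ((∑ i, ‖G i ()‖ ^ 2 : ℝ) : 𝕜) := by
          rw [hsum, hsum, Matrix.conjTranspose_mul, Matrix.mul_assoc, ← Matrix.mul_assoc Wᴴ, hW',
            Matrix.one_mul]
        exact_mod_cast this
      rw [h2]
      simp only [h1, Matrix.star_mulVec]
      rwa [← Matrix.dotProduct_mulVec, Matrix.mulVec_mulVec, hW', Matrix.one_mulVec]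
  -- `R` is a scalar here, and both sides of the inequality scale by `‖R‖ ^ 2`.
  · rintro R - V G ⟨c, hc, hV, hle⟩
    refine ⟨c, hc, hV, ?_⟩
    have h1 : (fun i => (G * R) i ()) = R () () • fun i => G i () := by
      ext i
      simp [Matrix.mul_apply, mul_comm]
    have h2 : ∀ i, (G * R) i () = R () () * G i () := fun i => congrFun h1 i
    rw [h1]
    simp only [h2, norm_mul, dotProduct_smul, smul_eq_mul, mul_pow, ← Finset.mul_sum]
    calc _ ≤ ‖R () ()‖ ^ 2 * (s ^ 2 * ∑ i, ‖G i ()‖ ^ 2) := by gcongr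
      _ = _ := by ring
  · have h0 : ∀ᵐ g ∂γ, g ≠ 0 := by
      rw [ae_iff]
      simpa using hγ.singleton_zero
    rw [ae_map_iff hrep.aemeasurable]
    · filter_upwards [h0] with g hg
      obtain ⟨i, hi⟩ := Function.ne_iff.1 hg
      rw [hdet, RCLike.ofReal_ne_zero]
      refine (Finset.sum_pos' (fun _ _ => sq_nonneg _) ⟨i, Finset.mem_univ i, ?_⟩).ne'
      have : 0 < ‖g i‖ := norm_pos_iff.2 hi
      simpa using pow_pos this 2
    · apply IsOpen.measurableSet
      exact isOpen_ne_fun (Continuous.matrix_det (Continuous.matrix_mul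
        (Continuous.matrix_conjTranspose continuous_id) continuous_id)) continuous_const
  · rw [hdet]
    simp [Pi.single_apply, apply_ite norm, ite_pow]

end Kernel

/-! ### Rotation invariance of the Euclidean ball -/

section Ball

variable {𝕜 : Type*} [RCLike 𝕜]

/-- The Euclidean unit ball. -/
def euclideanBall (𝕜 ι : Type*) [RCLike 𝕜] [Fintype ι] : Set (ι → 𝕜) := {g | ∑ i, ‖g i‖ ^ 2 < 1}

lemma isOpen_euclideanBall {ι : Type*} [Fintype ι] : IsOpen (euclideanBall 𝕜 ι) :=
  isOpen_lt (continuous_finsetSum _ fun i _ => (continuous_apply i).norm.pow 2) continuous_const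

lemma zero_mem_euclideanBall {ι : Type*} [Fintype ι] : (0 : ι → 𝕜) ∈ euclideanBall 𝕜 ι := by
  simp [euclideanBall]

lemma euclideanBall_subset_closedBall {ι : Type*} [Fintype ι] :
    euclideanBall 𝕜 ι ⊆ Metric.closedBall 0 1 := by
  intro c hc
  rw [mem_closedBall_zero_iff, pi_norm_le_iff_of_nonneg zero_le_one]
  intro i
  have h1 : ‖c i‖ ^ 2 ≤ ∑ i, ‖c i‖ ^ 2 :=
    Finset.single_le_sum (f := fun i => ‖c i‖ ^ 2) (fun _ _ => sq_nonneg _) (Finset.mem_univ i)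
  exact (sq_le_one_iff₀ (norm_nonneg _)).1 (h1.trans (le_of_lt hc))

lemma sum_norm_sq_mulVec_of_unitary {ι : Type*} [Fintype ι] [DecidableEq ι] {W : Matrix ι ι 𝕜}
    (hW : Wᴴ * W = 1) (g : ι → 𝕜) : ∑ i, ‖(W *ᵥ g) i‖ ^ 2 = ∑ i, ‖g i‖ ^ 2 := by
  have h : star (W *ᵥ g) ⬝ᵥ (W *ᵥ g) = star g ⬝ᵥ g := by
    rw [Matrix.star_mulVec, ← Matrix.dotProduct_mulVec, Matrix.mulVec_mulVec, hW,
      Matrix.one_mulVec]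
  rw [star_dotProduct_self, star_dotProduct_self] at h
  exact_mod_cast h

variable [MeasurableSpace 𝕜] [BorelSpace 𝕜]

section

variable {ι : Type*} [Fintype ι] {vol : Measure (ι → 𝕜)} [vol.IsAddHaarMeasure]

omit [BorelSpace 𝕜] in
lemma measure_euclideanBall_ne_zero : vol (euclideanBall 𝕜 ι) ≠ 0 :=
  (isOpen_euclideanBall.measure_pos vol ⟨0, zero_mem_euclideanBall⟩).ne'

omit [BorelSpace 𝕜] in
lemma measure_euclideanBall_ne_top : vol (euclideanBall 𝕜 ι) ≠ ⊤ :=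
  ((measure_mono euclideanBall_subset_closedBall).trans_lt
    (isCompact_closedBall (0 : ι → 𝕜) 1).measure_lt_top).ne

/-- A real-linear bijection multiplies Haar measure by a constant. A unitary matrix preserves the
Euclidean ball, whose measure is positive and finite, so the constant is one. -/
lemma measurePreserving_mulVec_of_unitary [DecidableEq ι] {W : Matrix ι ι 𝕜} (hW : Wᴴ * W = 1) :
    MeasurePreserving (fun g => W *ᵥ g) vol vol := by
  let f : (ι → 𝕜) →ₗ[ℝ] (ι → 𝕜) := W.mulVecLin.restrictScalars ℝ
  let f' : (ι → 𝕜) →ₗ[ℝ] (ι → 𝕜) := Wᴴ.mulVecLin.restrictScalars ℝ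
  have hff : f' ∘ₗ f = LinearMap.id := by
    refine LinearMap.ext fun g => ?_
    simp [f, f', Matrix.mulVec_mulVec, hW]
  have hdet : LinearMap.det f ≠ 0 := by
    intro h
    have := congrArg LinearMap.det hff
    rw [LinearMap.det_comp, h, mul_zero, LinearMap.det_id] at this
    exact zero_ne_one this
  have hmap := Measure.map_linearMap_addHaar_eq_smul_addHaar vol hdet
  have hmeas : Measurable (fun g : ι → 𝕜 => W *ᵥ g) :=
    (Continuous.matrix_mulVec continuous_const continuous_id).measurable
  have hpre : (fun g => W *ᵥ g) ⁻¹' euclideanBall 𝕜 ι = euclideanBall 𝕜 ι := by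
    ext g
    simp [euclideanBall, sum_norm_sq_mulVec_of_unitary hW]
  have hB : vol (euclideanBall 𝕜 ι) =
      ENNReal.ofReal |(LinearMap.det f)⁻¹| * vol (euclideanBall 𝕜 ι) := by
    have h1 : (vol.map f) (euclideanBall 𝕜 ι) = vol (euclideanBall 𝕜 ι) := by
      conv_rhs => rw [← hpre]
      exact Measure.map_apply hmeas isOpen_euclideanBall.measurableSet
    rw [hmap, Measure.smul_apply, smul_eq_mul] at h1
    exact h1.symm
  have hone : ENNReal.ofReal |(LinearMap.det f)⁻¹| = 1 := by
    have := ENNReal.mul_right_inj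
      (b := ENNReal.ofReal |(LinearMap.det f)⁻¹|) (c := 1) (a := vol (euclideanBall 𝕜 ι))
      measure_euclideanBall_ne_zero measure_euclideanBall_ne_top
    rw [← this, mul_one, mul_comm]
    exact hB.symm
  rw [hone, one_smul] at hmap
  exact ⟨hmeas, hmap⟩

/-- By rotation invariance, it suffices to bound the component along one coordinate axis. -/
lemma isComponentBound_cond_euclideanBall [DecidableEq ι] (i₀ : ι) [NullSingletonClass vol] {s : ℝ} {p : ℝ≥0∞}
    (h : vol (euclideanBall 𝕜 ι ∩ {g | ‖g i₀‖ ^ 2 ≤ s ^ 2 * ∑ i, ‖g i‖ ^ 2}) ≤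
      p * vol (euclideanBall 𝕜 ι)) :
    IsComponentBound (ProbabilityTheory.cond vol (euclideanBall 𝕜 ι)) s p where
  isProbabilityMeasure := ProbabilityTheory.cond_isProbabilityMeasure_of_finite
    measure_euclideanBall_ne_zero measure_euclideanBall_ne_top
  singleton_zero := by
    rw [ProbabilityTheory.cond_apply isOpen_euclideanBall.measurableSet]
    have : vol (euclideanBall 𝕜 ι ∩ {0}) = 0 :=
      measure_mono_null Set.inter_subset_right (measure_singleton _)
    rw [this, mul_zero]
  le := by
    intro c hc
    have hgram : ∀ v : ι → 𝕜, ((Matrix.replicateCol Unit v)ᴴ * Matrix.replicateCol Unit v).det =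
        star v ⬝ᵥ v := by
      intro v
      rw [Matrix.det_unique]
      simp [Matrix.mul_apply, dotProduct]
    -- `W` carries the axis `i₀` to a multiple of `c` by a scalar of modulus one, so pulling back
    -- along `W` turns the component along `c` into the coordinate `i₀`, up to a phase.
    obtain ⟨W, hW, R, hR, hWR⟩ := exists_unitary_mul_eq (𝕜 := 𝕜)
      (G := Matrix.replicateCol Unit (Pi.single i₀ (1 : 𝕜))) (G' := Matrix.replicateCol Unit c)
      (by rw [hgram]; simp) (by rw [hgram, hc]; exact one_ne_zero)
    have hW' : Wᴴ * W = 1 := Matrix.mem_unitaryGroup_iff'.1 hW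
    have hcol : W *ᵥ Pi.single i₀ 1 = R () () • c := by
      ext i
      have := congrFun (congrFun hWR i) ()
      simpa [Matrix.mul_apply, mul_comm, Matrix.mulVec, dotProduct] using this
    have hRn : ‖R () ()‖ ^ 2 = 1 := by
      have h1 := sum_norm_sq_mulVec_of_unitary hW' (Pi.single i₀ (1 : 𝕜))
      rw [hcol] at h1
      simp only [Pi.smul_apply, norm_smul, mul_pow, ← Finset.mul_sum,
        star_dotProduct_self_eq_one_iff.1 hc, mul_one] at h1
      simpa [Pi.single_apply, apply_ite norm, ite_pow] using h1
    have hcomp : ∀ g, ‖star c ⬝ᵥ (W *ᵥ g)‖ ^ 2 = ‖g i₀‖ ^ 2 := by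
      intro g
      have h1 : star (W *ᵥ Pi.single i₀ 1) ⬝ᵥ (W *ᵥ g) = g i₀ := by
        rw [Matrix.star_mulVec, ← Matrix.dotProduct_mulVec, Matrix.mulVec_mulVec, hW',
          Matrix.one_mulVec]
        simp
      rw [hcol, star_smul, smul_dotProduct] at h1
      rw [← h1, norm_smul, mul_pow, norm_star, hRn, one_mul]
    have hmeas : MeasurableSet (euclideanBall 𝕜 ι ∩
        {g | ‖star c ⬝ᵥ g‖ ^ 2 ≤ s ^ 2 * ∑ i, ‖g i‖ ^ 2}) := by
      refine isOpen_euclideanBall.measurableSet.inter (IsClosed.measurableSet ?_)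
      exact isClosed_le (((continuous_const.dotProduct continuous_id).norm).pow 2)
        (continuous_const.mul (continuous_finsetSum _ fun i _ => (continuous_apply i).norm.pow 2))
    rw [ProbabilityTheory.cond_apply isOpen_euclideanBall.measurableSet,
      ← (measurePreserving_mulVec_of_unitary (vol := vol) hW').measure_preimage
        hmeas.nullMeasurableSet]
    have hpre : (fun g => W *ᵥ g) ⁻¹' (euclideanBall 𝕜 ι ∩
        {g | ‖star c ⬝ᵥ g‖ ^ 2 ≤ s ^ 2 * ∑ i, ‖g i‖ ^ 2}) =
        euclideanBall 𝕜 ι ∩ {g | ‖g i₀‖ ^ 2 ≤ s ^ 2 * ∑ i, ‖g i‖ ^ 2} := by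
      ext g
      simp [euclideanBall, sum_norm_sq_mulVec_of_unitary hW', hcomp]
    rw [hpre, mul_comm, ← div_eq_mul_inv]
    exact ENNReal.div_le_of_le_mul h

end

end Ball

/-! ### Volume of a cone in terms of slopes -/

section Cone

variable {𝕜 : Type*} [RCLike 𝕜] {m : Type*} [Fintype m]

/-- The Euclidean norm of a coordinate vector. -/
noncomputable def euclideanNorm (y : m → 𝕜) : ℝ := Real.sqrt (∑ i, ‖y i‖ ^ 2)

lemma euclideanNorm_nonneg (y : m → 𝕜) : 0 ≤ euclideanNorm y := Real.sqrt_nonneg _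

lemma euclideanNorm_sq (y : m → 𝕜) : euclideanNorm y ^ 2 = ∑ i, ‖y i‖ ^ 2 :=
  Real.sq_sqrt (Finset.sum_nonneg fun _ _ => sq_nonneg _)

lemma continuous_euclideanNorm : Continuous (euclideanNorm : (m → 𝕜) → ℝ) :=
  (continuous_finsetSum _ fun i _ => (continuous_apply i).norm.pow 2).sqrt

lemma euclideanNorm_smul {r : ℝ} (hr : 0 ≤ r) (y : m → 𝕜) :
    euclideanNorm (r • y) = r * euclideanNorm y := by
  have h : ∑ i, ‖(r • y) i‖ ^ 2 = r ^ 2 * ∑ i, ‖y i‖ ^ 2 := by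
    simp only [Pi.smul_apply, norm_smul, mul_pow, Finset.mul_sum, Real.norm_eq_abs, sq_abs]
  rw [euclideanNorm, h, Real.sqrt_mul (sq_nonneg r), Real.sqrt_sq hr, euclideanNorm]

lemma euclideanNorm_eq_zero_iff {y : m → 𝕜} : euclideanNorm y = 0 ↔ y = 0 := by
  rw [euclideanNorm, Real.sqrt_eq_zero (Finset.sum_nonneg fun _ _ => sq_nonneg _),
    Finset.sum_eq_zero_iff_of_nonneg fun _ _ => sq_nonneg _]
  simp [funext_iff]

lemma sqrt_one_add_norm_sq_pos (v : 𝕜) : 0 < Real.sqrt (1 + ‖v‖ ^ 2) :=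
  Real.sqrt_pos.2 (by positivity)

variable [MeasurableSpace 𝕜] [BorelSpace 𝕜]

/-- The mass of a set of slopes `z / |y|` under the (unnormalized) law induced by a rotation
invariant distribution of `(y, z)`; here `D` is the real dimension of the ambient space. -/
noncomputable def slopeMass (ν : Measure 𝕜) (D : ℕ) (A : Set 𝕜) : ℝ≥0∞ :=
  ∫⁻ v in A, ENNReal.ofReal ((Real.sqrt (1 + ‖v‖ ^ 2) ^ D)⁻¹) ∂ν

variable {vol : Measure (m → 𝕜)} [vol.IsAddHaarMeasure] {ν : Measure 𝕜} [ν.IsAddHaarMeasure]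

lemma lintegral_comp_smul {f : (m → 𝕜) → ℝ≥0∞} (hf : Measurable f) {r : ℝ} (hr : 0 < r) :
    ∫⁻ y, f (r • y) ∂vol =
      ENNReal.ofReal ((r ^ Module.finrank ℝ (m → 𝕜))⁻¹) * ∫⁻ y, f y ∂vol := by
  rw [← lintegral_map hf (measurable_const_smul r), Measure.map_addHaar_smul vol hr.ne',
    lintegral_smul_measure, abs_of_pos (by positivity), smul_eq_mul]

/-- Polar coordinates for a cone in `𝕜 ^ m × 𝕜`, intersected with the unit ball. -/
lemma prod_setOf_slope_mem {A : Set 𝕜} (hA : MeasurableSet A) :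
    (vol.prod ν) {q | euclideanNorm q.1 ≠ 0 ∧ (euclideanNorm q.1)⁻¹ • q.2 ∈ A ∧
      euclideanNorm q.1 ^ 2 + ‖q.2‖ ^ 2 < 1} =
    (∫⁻ y in {y | euclideanNorm y < 1},
        ENNReal.ofReal (euclideanNorm y ^ Module.finrank ℝ 𝕜) ∂vol) *
      slopeMass ν (Module.finrank ℝ 𝕜 + Module.finrank ℝ (m → 𝕜)) A := by
  set d := Module.finrank ℝ 𝕜 with hd
  have hd0 : d ≠ 0 := Module.finrank_pos.ne'
  have hN : Measurable (euclideanNorm : (m → 𝕜) → ℝ) := continuous_euclideanNorm.measurable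
  have hlt : MeasurableSet {y : m → 𝕜 | euclideanNorm y < 1} := hN measurableSet_Iio
  let Φ : (m → 𝕜) → ℝ≥0∞ := {y | euclideanNorm y < 1}.indicator
    fun y => ENNReal.ofReal (euclideanNorm y ^ d)
  have hΦ : Measurable Φ := ((hN.pow_const d).ennreal_ofReal).indicator hlt
  have hρ : Measurable fun v : 𝕜 => Real.sqrt (1 + ‖v‖ ^ 2) := by fun_prop
  have hS : MeasurableSet {q : (m → 𝕜) × 𝕜 | euclideanNorm q.1 ≠ 0 ∧
      (euclideanNorm q.1)⁻¹ • q.2 ∈ A ∧ euclideanNorm q.1 ^ 2 + ‖q.2‖ ^ 2 < 1} := by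
    have h1 : Measurable fun q : (m → 𝕜) × 𝕜 => euclideanNorm q.1 := hN.comp measurable_fst
    refine (measurableSet_eq_fun h1 measurable_const).compl.inter
      (MeasurableSet.inter ((h1.inv.smul measurable_snd) hA) ?_)
    exact measurableSet_lt ((h1.pow_const 2).add (measurable_snd.norm.pow_const 2)) measurable_const
  rw [Measure.prod_apply hS]
  -- For fixed `y ≠ 0` substitute `z = |y| v`: the measure scales by `|y| ^ d`, and with `ρ = √(1 +
  -- ‖v‖²)` the ball condition reads `ρ |y| < 1`. The factor `ρ⁻ᵈ` makes the integrand a function of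
  -- `ρ y`.
  have hsec : ∀ y : m → 𝕜, ν (Prod.mk y ⁻¹' {q : (m → 𝕜) × 𝕜 | euclideanNorm q.1 ≠ 0 ∧
      (euclideanNorm q.1)⁻¹ • q.2 ∈ A ∧ euclideanNorm q.1 ^ 2 + ‖q.2‖ ^ 2 < 1}) =
      ∫⁻ v in A, ENNReal.ofReal ((Real.sqrt (1 + ‖v‖ ^ 2) ^ d)⁻¹) *
        Φ (Real.sqrt (1 + ‖v‖ ^ 2) • y) ∂ν := by
    intro y
    have hΦy : ∀ v : 𝕜, ENNReal.ofReal ((Real.sqrt (1 + ‖v‖ ^ 2) ^ d)⁻¹) *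
        Φ (Real.sqrt (1 + ‖v‖ ^ 2) • y) =
        {v : 𝕜 | Real.sqrt (1 + ‖v‖ ^ 2) * euclideanNorm y < 1}.indicator
          (fun _ => ENNReal.ofReal (euclideanNorm y ^ d)) v := by
      intro v
      have hpos := sqrt_one_add_norm_sq_pos v
      by_cases hv : Real.sqrt (1 + ‖v‖ ^ 2) * euclideanNorm y < 1
      · simp only [Φ, Set.indicator_apply, Set.mem_ofPred_eq, euclideanNorm_smul hpos.le, hv,
          if_true]
        rw [← ENNReal.ofReal_mul (by positivity), mul_pow, inv_mul_cancel_left₀ (by positivity)]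
      · simp [Φ, euclideanNorm_smul hpos.le, hv]
    have hlt' : MeasurableSet {v : 𝕜 | Real.sqrt (1 + ‖v‖ ^ 2) * euclideanNorm y < 1} :=
      measurableSet_lt (hρ.mul_const _) measurable_const
    simp only [hΦy]
    rw [lintegral_indicator_const hlt', Measure.restrict_apply hlt']
    -- At `y = 0` the section is empty, and the right side vanishes because `d ≠ 0`.
    rcases eq_or_ne (euclideanNorm y) 0 with h0 | h0
    · simp [h0, hd0]
    · have hpos : 0 < euclideanNorm y := lt_of_le_of_ne (euclideanNorm_nonneg y) h0.symm
      have hset : Prod.mk y ⁻¹' {q : (m → 𝕜) × 𝕜 | euclideanNorm q.1 ≠ 0 ∧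
          (euclideanNorm q.1)⁻¹ • q.2 ∈ A ∧ euclideanNorm q.1 ^ 2 + ‖q.2‖ ^ 2 < 1} =
          ((euclideanNorm y)⁻¹ • ·) ⁻¹'
            ({v : 𝕜 | Real.sqrt (1 + ‖v‖ ^ 2) * euclideanNorm y < 1} ∩ A) := by
        ext z
        simp only [Set.mem_preimage, Set.mem_ofPred_eq, Set.mem_inter_iff, ne_eq, h0,
          not_false_eq_true, true_and]
        rw [and_comm]
        refine and_congr_left fun _ => ?_
        rw [← sq_lt_one_iff₀ (a := Real.sqrt (1 + ‖(euclideanNorm y)⁻¹ • z‖ ^ 2) * euclideanNorm y)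
          (by positivity), mul_pow, Real.sq_sqrt (by positivity), norm_smul,
          norm_inv, Real.norm_of_nonneg hpos.le]
        field_simp
      rw [hset, Measure.addHaar_preimage_smul ν (inv_ne_zero h0), inv_pow, inv_inv,
        abs_of_nonneg (by positivity)]
  simp only [hsec]
  -- After the swap, rescaling `y` by `ρ` contributes the remaining power of `ρ⁻¹` and leaves an
  -- integral over `y` that does not depend on `v`.
  rw [lintegral_lintegral_swap]
  · have hin : ∀ v : 𝕜, ∫⁻ y, ENNReal.ofReal ((Real.sqrt (1 + ‖v‖ ^ 2) ^ d)⁻¹) *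
        Φ (Real.sqrt (1 + ‖v‖ ^ 2) • y) ∂vol = (∫⁻ y, Φ y ∂vol) *
        ENNReal.ofReal ((Real.sqrt (1 + ‖v‖ ^ 2) ^ (d + Module.finrank ℝ (m → 𝕜)))⁻¹) := by
      intro v
      have hpos := sqrt_one_add_norm_sq_pos v
      have hΦ' : Measurable fun y => Φ (Real.sqrt (1 + ‖v‖ ^ 2) • y) :=
        hΦ.comp (measurable_const_smul _)
      rw [lintegral_const_mul _ hΦ', lintegral_comp_smul hΦ hpos,
        ← mul_assoc, ← ENNReal.ofReal_mul (by positivity), ← mul_inv, ← pow_add, mul_comm]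
    simp only [hin]
    have hD : Measurable fun v : 𝕜 => ENNReal.ofReal
        ((Real.sqrt (1 + ‖v‖ ^ 2) ^ (d + Module.finrank ℝ (m → 𝕜)))⁻¹) :=
      (hρ.pow_const _).inv.ennreal_ofReal
    rw [lintegral_const_mul _ hD, lintegral_indicator hlt,
      slopeMass]
  · refine Measurable.aemeasurable (Measurable.mul ?_ ?_)
    · exact ((hρ.comp measurable_snd).pow_const d).inv.ennreal_ofReal
    · exact hΦ.comp ((hρ.comp measurable_snd).smul measurable_fst)

end Cone

/-! ### From slopes to components of a unit vector -/

section Component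

variable {𝕜 : Type*} [RCLike 𝕜] [MeasurableSpace 𝕜] [BorelSpace 𝕜] {m : Type*} [Fintype m]
  [DecidableEq m]

/-- The distribution of one component of a random unit vector in terms of slopes. -/
lemma exists_isComponentBound [Nonempty m] (ν : Measure 𝕜) [ν.IsAddHaarMeasure] {s a : ℝ}
    (hs : 0 ≤ s) (hs1 : s < 1) (ha : a = s / Real.sqrt (1 - s ^ 2)) {p : ℝ≥0∞}
    (h : slopeMass ν (Module.finrank ℝ 𝕜 + Module.finrank ℝ (m → 𝕜)) (Metric.closedBall 0 a) ≤
      p * slopeMass ν (Module.finrank ℝ 𝕜 + Module.finrank ℝ (m → 𝕜)) Set.univ) :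
    ∃ γ : Measure (m ⊕ Unit → 𝕜), IsComponentBound γ s p := by
  let vol : Measure (m ⊕ Unit → 𝕜) := Measure.pi fun _ => ν
  let volm : Measure (m → 𝕜) := Measure.pi fun _ => ν
  have : NullSingletonClass ν := inferInstance
  have : NullSingletonClass vol := inferInstanceAs (NullSingletonClass (Measure.pi fun _ => ν))
  refine ⟨ProbabilityTheory.cond vol (euclideanBall 𝕜 (m ⊕ Unit)),
    isComponentBound_cond_euclideanBall (Sum.inr ()) ?_⟩
  let φ : (m ⊕ Unit → 𝕜) → (m → 𝕜) × 𝕜 := fun g => (fun i => g (Sum.inl i), g (Sum.inr ()))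
  have hφ : MeasurePreserving φ vol (volm.prod ν) := by
    have h1 := measurePreserving_sumPiEquivProdPi (X := fun _ : m ⊕ Unit => 𝕜) (fun _ => ν)
    have h2 := (MeasurePreserving.id volm).prod (measurePreserving_funUnique (α := Unit) ν)
    exact h2.comp h1
  have h1s : 0 < 1 - s ^ 2 := by nlinarith
  have hr : 0 < Real.sqrt (1 - s ^ 2) := Real.sqrt_pos.2 h1s
  have hr2 : Real.sqrt (1 - s ^ 2) ^ 2 = 1 - s ^ 2 := Real.sq_sqrt h1s.le
  have hsum : ∀ g : m ⊕ Unit → 𝕜,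
      ∑ i, ‖g i‖ ^ 2 = euclideanNorm (φ g).1 ^ 2 + ‖(φ g).2‖ ^ 2 := by
    intro g
    simp [euclideanNorm_sq, Fintype.sum_sum_type, φ]
  have hnull : ∀ᵐ g ∂vol, euclideanNorm (φ g).1 ≠ 0 := by
    have h1 : ∀ᵐ q ∂(volm.prod ν), euclideanNorm q.1 ≠ 0 := by
      have : ∀ᵐ y ∂volm, euclideanNorm y ≠ 0 := by
        rw [ae_iff]
        simp [euclideanNorm_eq_zero_iff]
      exact Measure.quasiMeasurePreserving_fst.ae this
    exact hφ.quasiMeasurePreserving.ae h1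
  have hmeas : ∀ A : Set 𝕜, MeasurableSet A → MeasurableSet {q : (m → 𝕜) × 𝕜 |
      euclideanNorm q.1 ≠ 0 ∧ (euclideanNorm q.1)⁻¹ • q.2 ∈ A ∧
        euclideanNorm q.1 ^ 2 + ‖q.2‖ ^ 2 < 1} := by
    intro A hA
    have h1 : Measurable fun q : (m → 𝕜) × 𝕜 => euclideanNorm q.1 :=
      continuous_euclideanNorm.measurable.comp measurable_fst
    refine (measurableSet_eq_fun h1 measurable_const).compl.inter
      (MeasurableSet.inter ((h1.inv.smul measurable_snd) hA) ?_)
    exact measurableSet_lt ((h1.pow_const 2).add (measurable_snd.norm.pow_const 2)) measurable_const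
  have hB : vol (euclideanBall 𝕜 (m ⊕ Unit)) = (volm.prod ν) {q | euclideanNorm q.1 ≠ 0 ∧
      (euclideanNorm q.1)⁻¹ • q.2 ∈ Set.univ ∧ euclideanNorm q.1 ^ 2 + ‖q.2‖ ^ 2 < 1} := by
    rw [← hφ.measure_preimage (hmeas _ MeasurableSet.univ).nullMeasurableSet]
    refine measure_congr ?_
    filter_upwards [hnull] with g hg
    apply propext
    change ∑ i, ‖g i‖ ^ 2 < 1 ↔ (euclideanNorm (φ g).1 ≠ 0 ∧ _ ∈ Set.univ ∧
      euclideanNorm (φ g).1 ^ 2 + ‖(φ g).2‖ ^ 2 < 1)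
    simp [hsum, hg]
  have hS : vol (euclideanBall 𝕜 (m ⊕ Unit) ∩
      {g | ‖g (Sum.inr ())‖ ^ 2 ≤ s ^ 2 * ∑ i, ‖g i‖ ^ 2}) =
      (volm.prod ν) {q | euclideanNorm q.1 ≠ 0 ∧
      (euclideanNorm q.1)⁻¹ • q.2 ∈ Metric.closedBall 0 a ∧
        euclideanNorm q.1 ^ 2 + ‖q.2‖ ^ 2 < 1} := by
    rw [← hφ.measure_preimage (hmeas _ Metric.isClosed_closedBall.measurableSet).nullMeasurableSet]
    refine measure_congr ?_
    filter_upwards [hnull] with g hg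
    apply propext
    change (∑ i, ‖g i‖ ^ 2 < 1 ∧ ‖(φ g).2‖ ^ 2 ≤ s ^ 2 * ∑ i, ‖g i‖ ^ 2) ↔
      (euclideanNorm (φ g).1 ≠ 0 ∧ (euclideanNorm (φ g).1)⁻¹ • (φ g).2 ∈ Metric.closedBall 0 a ∧
      euclideanNorm (φ g).1 ^ 2 + ‖(φ g).2‖ ^ 2 < 1)
    have hpos : 0 < euclideanNorm (φ g).1 := lt_of_le_of_ne (euclideanNorm_nonneg _) hg.symm
    rw [hsum, mem_closedBall_zero_iff, norm_smul, norm_inv, Real.norm_of_nonneg hpos.le]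
    generalize euclideanNorm (φ g).1 = N at *
    have hz : 0 ≤ ‖(φ g).2‖ := norm_nonneg _
    generalize ‖(φ g).2‖ = z at *
    -- If `s` is the sine of the angle to the hyperplane `z = 0`, the slope bound `a = s / √(1 -
    -- s²)` is its tangent.
    have hiff : z ^ 2 ≤ s ^ 2 * (N ^ 2 + z ^ 2) ↔ N⁻¹ * z ≤ a := by
      rw [ha, inv_mul_le_iff₀ hpos, mul_div_assoc', le_div_iff₀ hr,
        ← pow_le_pow_iff_left₀ (a := z * _) (by positivity) (by positivity) two_ne_zero, mul_pow z,
        mul_pow N, hr2]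
      constructor <;> intro h <;> linarith
    rw [hiff]
    exact ⟨fun h => ⟨hg, h.2, h.1⟩, fun h => ⟨h.2.2, h.2.1⟩⟩
  rw [hS, hB, prod_setOf_slope_mem Metric.isClosed_closedBall.measurableSet,
    prod_setOf_slope_mem MeasurableSet.univ]
  calc _ ≤ _ := mul_le_mul_right h _
    _ = _ := by ring

end Component

/-! ### The complex slope integral -/

section Complex

lemma hasDerivAt_slope_primitive (k : ℕ) (r : ℝ) :
    HasDerivAt (fun r : ℝ => -((1 + r ^ 2) ^ (k + 1))⁻¹ / (2 * ((k : ℝ) + 1)))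
      (r * ((1 + r ^ 2) ^ (k + 2))⁻¹) r := by
  have hpos : (0 : ℝ) < 1 + r ^ 2 := by positivity
  have h1 : HasDerivAt (fun r : ℝ => 1 + r ^ 2) (2 * r) r := by
    simpa using (hasDerivAt_pow 2 r).const_add 1
  have h2 := (((h1.pow (k + 1)).inv (pow_pos hpos _).ne').neg).div_const (2 * ((k : ℝ) + 1))
  refine h2.congr_deriv ?_
  have : (k : ℝ) + 1 ≠ 0 := by positivity
  push_cast
  simp only [Pi.pow_apply]
  field_simp
  ring

lemma tendsto_slope_primitive (k : ℕ) :
    Filter.Tendsto (fun r : ℝ => -((1 + r ^ 2) ^ (k + 1))⁻¹ / (2 * ((k : ℝ) + 1))) Filter.atTop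
      (nhds 0) := by
  have h1 : Filter.Tendsto (fun r : ℝ => (1 + r ^ 2) ^ (k + 1)) Filter.atTop Filter.atTop := by
    refine (Filter.tendsto_pow_atTop (Nat.succ_ne_zero k)).comp ?_
    exact Filter.tendsto_atTop_add_const_left _ _ (Filter.tendsto_pow_atTop two_ne_zero)
  simpa using (h1.inv_tendsto_atTop.neg).div_const (2 * ((k : ℝ) + 1))

lemma lintegral_Ioi_slope (k : ℕ) :
    ∫⁻ r in Set.Ioi (0 : ℝ), ENNReal.ofReal (r * ((1 + r ^ 2) ^ (k + 2))⁻¹) =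
      ENNReal.ofReal (1 / (2 * ((k : ℝ) + 1))) := by
  have hnn : ∀ r ∈ Set.Ioi (0 : ℝ), 0 ≤ r * ((1 + r ^ 2) ^ (k + 2))⁻¹ := fun r hr => by
    have : 0 < r := hr
    positivity
  rw [← ofReal_integral_eq_lintegral_ofReal]
  · rw [integral_Ioi_of_hasDerivAt_of_nonneg' (fun r _ => hasDerivAt_slope_primitive k r) hnn
      (tendsto_slope_primitive k)]
    congr 1
    simp [neg_div]
  · exact integrableOn_Ioi_deriv_of_nonneg' (fun r _ => hasDerivAt_slope_primitive k r) hnn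
      (tendsto_slope_primitive k)
  · exact ae_restrict_of_forall_mem measurableSet_Ioi hnn

lemma lintegral_Ioc_slope (k : ℕ) {a : ℝ} (ha : 0 ≤ a) :
    ∫⁻ r in Set.Ioc (0 : ℝ) a, ENNReal.ofReal (r * ((1 + r ^ 2) ^ (k + 2))⁻¹) =
      ENNReal.ofReal ((1 - ((1 + a ^ 2) ^ (k + 1))⁻¹) / (2 * ((k : ℝ) + 1))) := by
  have hcont : Continuous fun r : ℝ => r * ((1 + r ^ 2) ^ (k + 2))⁻¹ :=
    continuous_id.mul (Continuous.inv₀ (by fun_prop) fun r => by positivity)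
  rw [← ofReal_integral_eq_lintegral_ofReal]
  · rw [← intervalIntegral.integral_of_le ha, intervalIntegral.integral_eq_sub_of_hasDerivAt
      (fun r _ => hasDerivAt_slope_primitive k r) (hcont.intervalIntegrable _ _)]
    congr 1
    simp
    ring
  · exact (hcont.integrableOn_Icc).mono_set Set.Ioc_subset_Icc_self
  · refine ae_restrict_of_forall_mem measurableSet_Ioc fun r hr => ?_
    have : 0 < r := hr.1
    positivity

/-- Polar coordinates for the slope mass of a rotation invariant set. -/
lemma slopeMass_complex (k : ℕ) {S : Set ℝ} (hS : MeasurableSet S) :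
    slopeMass (volume : Measure ℂ) (2 * (k + 2)) {v | ‖v‖ ∈ S} =
      ENNReal.ofReal (2 * Real.pi) *
        ∫⁻ r in S ∩ Set.Ioi 0, ENNReal.ofReal (r * ((1 + r ^ 2) ^ (k + 2))⁻¹) := by
  classical
  have hmS : MeasurableSet {v : ℂ | ‖v‖ ∈ S} := measurable_norm hS
  have hmeas : Measurable fun r : ℝ => ENNReal.ofReal (r * ((1 + r ^ 2) ^ (k + 2))⁻¹) := by
    fun_prop
  rw [slopeMass, ← lintegral_indicator hmS, ← Complex.lintegral_comp_polarCoord_symm,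
    polarCoord_target]
  have h : ∀ p ∈ Set.Ioi (0 : ℝ) ×ˢ Set.Ioo (-Real.pi) Real.pi,
      ENNReal.ofReal p.1 • ({v : ℂ | ‖v‖ ∈ S}.indicator
        (fun v => ENNReal.ofReal ((Real.sqrt (1 + ‖v‖ ^ 2) ^ (2 * (k + 2)))⁻¹)))
          (Complex.polarCoord.symm p) =
      S.indicator (fun r => ENNReal.ofReal (r * ((1 + r ^ 2) ^ (k + 2))⁻¹)) p.1 := by
    rintro ⟨r, θ⟩ ⟨hr, -⟩
    have hr : 0 < r := hr
    have hn : ‖Complex.polarCoord.symm (r, θ)‖ = r := by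
      rw [Complex.norm_polarCoord_symm, abs_of_pos hr]
    simp only [Set.indicator_apply, Set.mem_ofPred_eq, hn]
    split_ifs
    · rw [pow_mul, Real.sq_sqrt (by positivity), smul_eq_mul, ENNReal.ofReal_mul hr.le]
    · simp
  rw [setLIntegral_congr_fun (measurableSet_Ioi.prod measurableSet_Ioo) h,
    Measure.volume_eq_prod, ← Measure.prod_restrict]
  have hind : Measurable fun p : ℝ × ℝ =>
      S.indicator (fun r => ENNReal.ofReal (r * ((1 + r ^ 2) ^ (k + 2))⁻¹)) p.1 :=
    (hmeas.indicator hS).comp measurable_fst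
  rw [lintegral_prod _ hind.aemeasurable]
  simp only [lintegral_const, Measure.restrict_apply MeasurableSet.univ, Set.univ_inter,
    Real.volume_Ioo]
  rw [lintegral_mul_const _ (hmeas.indicator hS), lintegral_indicator hS,
    Measure.restrict_restrict hS, mul_comm]
  congr 2
  ring

lemma slopeMass_complex_le (k : ℕ) {s a : ℝ} (hs : 0 ≤ s) (hs1 : s < 1)
    (ha : a = s / Real.sqrt (1 - s ^ 2)) :
    slopeMass (volume : Measure ℂ) (2 * (k + 2)) (Metric.closedBall 0 a) ≤
      ENNReal.ofReal ((k + 1) * s ^ 2) *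
        slopeMass (volume : Measure ℂ) (2 * (k + 2)) Set.univ := by
  have h1s : 0 < 1 - s ^ 2 := by nlinarith
  have ha0 : 0 ≤ a := by rw [ha]; positivity
  have h1 : (Metric.closedBall 0 a : Set ℂ) = {v | ‖v‖ ∈ Set.Iic a} := by
    ext v
    simp
  have h2 : (Set.univ : Set ℂ) = {v | ‖v‖ ∈ (Set.univ : Set ℝ)} := by simp
  rw [h1, h2, slopeMass_complex k measurableSet_Iic, slopeMass_complex k MeasurableSet.univ,
    Set.univ_inter, Set.inter_comm, Set.Ioi_inter_Iic, lintegral_Ioi_slope,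
    lintegral_Ioc_slope k ha0, mul_left_comm]
  refine mul_le_mul_right ?_ _
  rw [← ENNReal.ofReal_mul (by positivity)]
  refine ENNReal.ofReal_le_ofReal ?_
  have h3 : (1 + a ^ 2)⁻¹ = 1 - s ^ 2 := by
    rw [ha, div_pow, Real.sq_sqrt h1s.le]
    field_simp
    ring
  rw [← inv_pow, h3, mul_one_div]
  gcongr
  -- Since `1 / (1 + a²) = 1 - s²`, the ratio of the two masses is `1 - (1 - s²) ^ (k + 1)`, and
  -- Bernoulli's inequality bounds it by `(k + 1) s²`.
  have := one_add_mul_le_pow (a := -s ^ 2) (by nlinarith) (k + 1)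
  push_cast at this
  rw [← sub_eq_add_neg] at this
  linarith

lemma exists_isComponentBound_complex {m : Type*} [Fintype m] [DecidableEq m] [Nonempty m] {s : ℝ}
    (hs : 0 ≤ s) (hs1 : s < 1) :
    ∃ γ : Measure (m ⊕ Unit → ℂ),
      IsComponentBound γ s (ENNReal.ofReal (Fintype.card m * s ^ 2)) := by
  refine exists_isComponentBound volume hs hs1 rfl ?_
  obtain ⟨k, hk⟩ : ∃ k, Fintype.card m = k + 1 :=
    Nat.exists_eq_succ_of_ne_zero Fintype.card_ne_zero
  -- Here `k` is one less than the number of columns, so the ambient space is `ℂ ^ (k + 2)`.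
  have hD : Module.finrank ℝ ℂ + Module.finrank ℝ (m → ℂ) = 2 * (k + 2) := by
    rw [Module.finrank_pi_fintype, Finset.sum_const, Finset.card_univ, hk,
      Complex.finrank_real_complex, smul_eq_mul]
    ring
  rw [hD, hk]
  push_cast
  exact slopeMass_complex_le k hs hs1 rfl

end Complex

/-! ### The real slope integral -/

section Real

open Real

/-- The Wallis recursion makes `(n + 1)` times this product independent of `n`. -/
lemma integral_sin_pow_mul_integral_sin_pow_succ (n : ℕ) :
    (∫ x in (0 : ℝ)..π, sin x ^ n) * ∫ x in (0 : ℝ)..π, sin x ^ (n + 1) = 2 * π / (n + 1) := by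
  induction n with
  | zero => norm_num; ring
  | succ n ih =>
    rw [integral_sin_pow n]
    simp only [sin_zero, sin_pi, ne_eq, Nat.succ_ne_zero, not_false_eq_true, zero_pow, zero_mul,
      sub_self, zero_div, zero_add]
    rw [mul_left_comm, mul_comm (∫ x in (0 : ℝ)..π, sin x ^ (n + 1)), ih]
    push_cast
    field_simp
    ring

/-- The Wallis integrals decrease, so the square of the `n`-th one dominates its product with the
next, which is known exactly. -/
lemma sqrt_le_integral_cos_pow (n : ℕ) :
    √(2 * π / (n + 1)) ≤ ∫ x in (-(π / 2))..(π / 2), cos x ^ n := by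
  have hshift : ∫ x in (-(π / 2))..(π / 2), cos x ^ n = ∫ x in (0 : ℝ)..π, sin x ^ n := by
    have h := intervalIntegral.integral_comp_add_right (a := -(π / 2)) (b := π / 2)
      (fun x => sin x ^ n) (π / 2)
    simp only [sin_add_pi_div_two] at h
    rw [h]
    congr 1 <;> ring
  have hpos : 0 < ∫ x in (0 : ℝ)..π, sin x ^ n := integral_sin_pow_pos n
  rw [hshift, sqrt_le_left hpos.le, ← integral_sin_pow_mul_integral_sin_pow_succ, sq]
  gcongr
  exact integral_sin_pow_succ_le n

/-- Serves the exponent zero case below. It fails near `π / 2`, which is why the range stops at `π /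
4`. The proof uses `√(π/2) ≥ 1.25` and `sin x ≥ 0.8 x`, and `1.25 * 0.8 = 1`. -/
lemma le_sqrt_mul_sin {x : ℝ} (hx : 0 ≤ x) (hx' : x ≤ π / 4) : x ≤ √(π / 2) * sin x := by
  rcases hx.eq_or_lt with rfl | hx0
  · simp
  have h1 := sin_gt_sub_cube hx0
  have hπ : π < 3.15 := pi_lt_d2
  have hπ' : 3.14 < π := pi_gt_d2
  have h2 : (1.25 : ℝ) ≤ √(π / 2) := by
    rw [le_sqrt' (by norm_num)]
    linarith
  have h3 : x < 0.79 := by linarith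
  have h4 : x * 0.8 ≤ sin x := by nlinarith [mul_pos hx0 hx0]
  nlinarith

/-- For a positive exponent `cos ^ n ≤ cos`, so the left side is at most `2 sin x`, and the Wallis
bound absorbs the 2. For exponent zero this comparison is unavailable and the claim reduces to
`le_sqrt_mul_sin`. -/
lemma integral_cos_pow_le (n : ℕ) {x : ℝ} (hx : 0 ≤ x) (hx' : x ≤ π / 4) :
    ∫ y in (-x)..x, cos y ^ n ≤
      sin x * √(2 * (n + 1) / π) * ∫ y in (-(π / 2))..(π / 2), cos y ^ n := by
  have hπ := pi_pos
  have hsin : 0 ≤ sin x := sin_nonneg_of_nonneg_of_le_pi hx (by linarith)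
  rcases n with - | n
  · have h1 := le_sqrt_mul_sin hx hx'
    have h2 : √(2 / π) * π = 2 * √(π / 2) := by
      rw [← sq_eq_sq₀ (by positivity) (by positivity), mul_pow, mul_pow, sq_sqrt (by positivity),
        sq_sqrt (by positivity)]
      field_simp
    simp only [pow_zero, intervalIntegral.integral_const, smul_eq_mul, mul_one]
    rw [sub_neg_eq_add, sub_neg_eq_add, Nat.cast_zero, zero_add, mul_one]
    have h3 : sin x * √(2 / π) * (π / 2 + π / 2) = 2 * (√(π / 2) * sin x) := by
      rw [add_halves, mul_assoc, h2]
      ring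
    linarith
  · have hle : ∫ y in (-x)..x, cos y ^ (n + 1) ≤ ∫ y in (-x)..x, cos y := by
      refine intervalIntegral.integral_mono_on (by linarith)
        (Continuous.intervalIntegrable (continuous_cos.pow _) _ _)
        (continuous_cos.intervalIntegrable _ _) fun y hy => ?_
      exact pow_le_of_le_one (cos_nonneg_of_neg_pi_div_two_le_of_le (by linarith [hy.1])
        (by linarith [hy.2])) (cos_le_one y) (Nat.succ_ne_zero n)
    have h2 : √(2 * ((n + 1 : ℕ) + 1) / π) * √(2 * π / ((n + 1 : ℕ) + 1)) = 2 := by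
      rw [← sqrt_mul (by positivity)]
      have : (2 : ℝ) * ((n + 1 : ℕ) + 1) / π * (2 * π / ((n + 1 : ℕ) + 1)) = 2 ^ 2 := by
        field_simp
      rw [this, sqrt_sq (by norm_num)]
    have h3 := sqrt_le_integral_cos_pow (n + 1)
    calc _ ≤ _ := hle
      _ = sin x * 2 := by rw [integral_cos, sin_neg]; ring
      _ = sin x * √(2 * ((n + 1 : ℕ) + 1) / π) * √(2 * π / ((n + 1 : ℕ) + 1)) := by
        rw [mul_assoc, h2]
      _ ≤ _ := by gcongr

/-- The substitution `v = tan θ` in the slope mass. -/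
lemma slopeMass_real (n : ℕ) {A : Set ℝ} (hA : MeasurableSet A) :
    slopeMass (volume : Measure ℝ) (n + 2) A =
      ∫⁻ θ in arctan '' A, ENNReal.ofReal (cos θ ^ n) := by
  rw [lintegral_image_eq_lintegral_abs_deriv_mul hA
    (fun x _ => (hasDerivAt_arctan x).hasDerivWithinAt) arctan_injective.injOn, slopeMass]
  refine lintegral_congr fun x => ?_
  rw [← ENNReal.ofReal_mul (abs_nonneg _), abs_of_nonneg (by positivity), cos_arctan,
    Real.norm_eq_abs, sq_abs, pow_add, sq_sqrt (by positivity)]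
  congr 1
  have : √(1 + x ^ 2) ≠ 0 := (sqrt_pos.2 (by positivity)).ne'
  rw [div_pow, one_pow]
  field_simp

lemma lintegral_Icc_cos_pow (n : ℕ) {x : ℝ} (hx : 0 ≤ x) (hx' : x ≤ π / 2) :
    ∫⁻ θ in Set.Icc (-x) x, ENNReal.ofReal (cos θ ^ n) =
      ENNReal.ofReal (∫ θ in (-x)..x, cos θ ^ n) := by
  rw [intervalIntegral.integral_of_le (by linarith), ← integral_Icc_eq_integral_Ioc,
    ofReal_integral_eq_lintegral_ofReal]
  · exact Continuous.integrableOn_Icc (by fun_prop)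
  · refine ae_restrict_of_forall_mem measurableSet_Icc fun θ hθ => ?_
    exact pow_nonneg (cos_nonneg_of_neg_pi_div_two_le_of_le (by linarith [hθ.1])
        (by linarith [hθ.2])) n

lemma slopeMass_real_le (n : ℕ) {s a : ℝ} (hs : 0 ≤ s) (hs1 : s ^ 2 ≤ 1 / 2)
    (ha : a = s / √(1 - s ^ 2)) :
    slopeMass (volume : Measure ℝ) (n + 2) (Metric.closedBall 0 a) ≤
      ENNReal.ofReal (s * √(2 * (n + 1) / π)) *
        slopeMass (volume : Measure ℝ) (n + 2) Set.univ := by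
  have hs1' : s < 1 := by nlinarith
  -- The substitution `v = tan θ` turns the slope bound `a` into the angle `arcsin s`, which is at
  -- most `π / 4` because `s² ≤ 1/2`.
  have harc : arctan a = arcsin s := by
    rw [ha, arcsin_eq_arctan ⟨by linarith, hs1'⟩]
  have hx0 : 0 ≤ arcsin s := arcsin_nonneg.2 hs
  have hsin : sin (arcsin s) = s := sin_arcsin (by linarith) hs1'.le
  have hx1 : arcsin s ≤ π / 4 := by
    rw [arcsin_le_iff_le_sin ⟨by linarith, hs1'.le⟩ ⟨by linarith [pi_pos], by linarith [pi_pos]⟩,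
      sin_pi_div_four, ← sq_le_sq₀ hs (by positivity), div_pow, sq_sqrt (by norm_num)]
    linarith
  have himg : arctan '' Metric.closedBall 0 a = Set.Icc (-arcsin s) (arcsin s) := by
    rw [Real.closedBall_eq_Icc, zero_sub, zero_add, ← harc, ← arctan_neg]
    ext θ
    constructor
    · rintro ⟨x, hx, rfl⟩
      exact ⟨arctan_strictMono.monotone hx.1, arctan_strictMono.monotone hx.2⟩
    · rintro ⟨h1, h2⟩
      have h3 : θ ∈ Set.range arctan := by
        rw [range_arctan]
        exact ⟨(neg_pi_div_two_lt_arctan _).trans_le h1, h2.trans_lt (arctan_lt_pi_div_two _)⟩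
      obtain ⟨x, rfl⟩ := h3
      exact ⟨x, ⟨arctan_strictMono.le_iff_le.1 h1, arctan_strictMono.le_iff_le.1 h2⟩, rfl⟩
  rw [slopeMass_real n measurableSet_closedBall, slopeMass_real n MeasurableSet.univ,
    Set.image_univ, range_arctan, himg, setLIntegral_congr Ioo_ae_eq_Icc,
    lintegral_Icc_cos_pow n hx0 (by linarith [pi_pos]),
    lintegral_Icc_cos_pow n (by linarith [pi_pos]) le_rfl, ← ENNReal.ofReal_mul (by positivity)]
  refine ENNReal.ofReal_le_ofReal ?_
  have := integral_cos_pow_le n hx0 hx1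
  rwa [hsin] at this

lemma exists_isComponentBound_real {m : Type*} [Fintype m] [DecidableEq m] [Nonempty m] {s : ℝ}
    (hs : 0 ≤ s) (hs1 : s ^ 2 ≤ 1 / 2) :
    ∃ γ : Measure (m ⊕ Unit → ℝ),
      IsComponentBound γ s (ENNReal.ofReal (s * √(2 * Fintype.card m / π))) := by
  refine exists_isComponentBound volume hs (by nlinarith) rfl ?_
  obtain ⟨n, hn⟩ : ∃ n, Fintype.card m = n + 1 :=
    Nat.exists_eq_succ_of_ne_zero Fintype.card_ne_zero
  have hD : Module.finrank ℝ ℝ + Module.finrank ℝ (m → ℝ) = n + 2 := by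
    rw [Module.finrank_pi, Module.finrank_self, hn]
    ring
  rw [hD, hn]
  push_cast
  exact slopeMass_real_le n hs hs1 rfl

end Real

/-! ### Rank-completing perturbations -/

section Completion

variable {𝕜 : Type*} [RCLike 𝕜] {n k : ℕ}

/-- If the columns of `U` complement the range of `M`, a kernel vector of a completion
`M + U D Vᴴ` lies in the kernels of `M` and `Vᴴ`. -/
lemma mulVec_eq_zero_of_completion {M : Matrix (Fin n) (Fin n) 𝕜} {U V H : Matrix (Fin n) (Fin k) 𝕜}
    {D : Matrix (Fin k) (Fin k) 𝕜} (hD : D.det ≠ 0) (hHM : Hᴴ * M = 0) (hHU : (Hᴴ * U).det ≠ 0)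
    {v : Fin n → 𝕜} (hv : (M + U * D * Vᴴ) *ᵥ v = 0) : Vᴴ *ᵥ v = 0 ∧ M *ᵥ v = 0 := by
  have hinj : Function.Injective (Hᴴ * U * D).mulVec := by
    rw [Matrix.mulVec_injective_iff_isUnit, Matrix.isUnit_iff_isUnit_det, Matrix.det_mul]
    exact (mul_ne_zero hHU hD).isUnit
  have h1 : (Hᴴ * U * D) *ᵥ (Vᴴ *ᵥ v) = 0 := by
    have h := congrArg (Hᴴ *ᵥ ·) hv
    simp only [Matrix.mulVec_mulVec, Matrix.mul_add, hHM, zero_add, Matrix.mulVec_zero,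
      ← Matrix.mul_assoc] at h
    simpa only [Matrix.mulVec_mulVec, ← Matrix.mul_assoc] using h
  have h2 : Vᴴ *ᵥ v = 0 := hinj (by rw [h1, Matrix.mulVec_zero])
  refine ⟨h2, ?_⟩
  rwa [Matrix.add_mulVec, ← Matrix.mulVec_mulVec, h2, Matrix.mulVec_zero, add_zero] at hv

/-- A completion of `M` is nonsingular if `U` and `V` are in general position with respect to the
left and right kernels of `M`. -/
lemma det_completion_ne_zero {M : Matrix (Fin n) (Fin n) 𝕜} {U V H G : Matrix (Fin n) (Fin k) 𝕜}
    {D : Matrix (Fin k) (Fin k) 𝕜} (hD : D.det ≠ 0) (hHM : Hᴴ * M = 0) (hHU : (Hᴴ * U).det ≠ 0)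
    (hGM : ∀ v, M *ᵥ v = 0 → ∃ c, v = G *ᵥ c) (hGV : (Gᴴ * V).det ≠ 0) :
    (M + U * D * Vᴴ).det ≠ 0 := by
  rw [← isUnit_iff_ne_zero, ← Matrix.isUnit_iff_isUnit_det, ← Matrix.mulVec_injective_iff_isUnit]
  rw [← Matrix.coe_mulVecLin, ← LinearMap.ker_eq_bot, LinearMap.ker_eq_bot']
  intro v hv
  obtain ⟨h1, h2⟩ := mulVec_eq_zero_of_completion hD hHM hHU hv
  obtain ⟨c, rfl⟩ := hGM v h2
  have hinj : Function.Injective (Vᴴ * G).mulVec := by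
    rw [Matrix.mulVec_injective_iff_isUnit, Matrix.isUnit_iff_isUnit_det,
      ← Matrix.conjTranspose_conjTranspose G, ← Matrix.conjTranspose_mul,
      Matrix.det_conjTranspose]
    exact (star_ne_zero.2 hGV).isUnit
  have h3 : c = 0 := hinj (by rw [← Matrix.mulVec_mulVec, h1, Matrix.mulVec_zero])
  rw [h3, Matrix.mulVec_zero]

lemma exists_kernel_matrix {M : Matrix (Fin n) (Fin n) 𝕜} (hM : M.rank + k = n) :
    ∃ G : Matrix (Fin n) (Fin k) 𝕜, (Gᴴ * G).det ≠ 0 ∧ M * G = 0 ∧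
      ∀ v, M *ᵥ v = 0 → ∃ c, v = G *ᵥ c := by
  have hker : Module.finrank 𝕜 (LinearMap.ker M.mulVecLin) = k := by
    have h := LinearMap.finrank_range_add_finrank_ker M.mulVecLin
    rw [← Matrix.rank, Module.finrank_pi, Fintype.card_fin] at h
    omega
  let b := Module.finBasisOfFinrankEq 𝕜 (LinearMap.ker M.mulVecLin) hker
  have hG : ∀ c, (Matrix.of fun i j => (b j : Fin n → 𝕜) i) *ᵥ c =
      ((∑ j, c j • b j : LinearMap.ker M.mulVecLin) : Fin n → 𝕜) := by
    intro c
    ext i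
    simp [Matrix.mulVec, dotProduct, mul_comm]
  refine ⟨Matrix.of fun i j => (b j : Fin n → 𝕜) i, ?_, ?_, ?_⟩
  · rw [← isUnit_iff_ne_zero, ← Matrix.isUnit_iff_isUnit_det,
      ← Matrix.mulVec_injective_iff_isUnit, ← Matrix.coe_mulVecLin, ← LinearMap.ker_eq_bot,
      Matrix.ker_mulVecLin_conjTranspose_mul_self, LinearMap.ker_eq_bot']
    intro c hc
    rw [Matrix.mulVecLin_apply, hG] at hc
    have h0 : ∑ j, c j • b j = 0 := Subtype.ext hc
    ext j
    exact Fintype.linearIndependent_iff.1 b.linearIndependent c h0 j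
  · ext i j
    exact congrFun (LinearMap.mem_ker.1 (b j).2) i
  · intro v hv
    refine ⟨b.repr ⟨v, by simpa using hv⟩, ?_⟩
    rw [hG, b.sum_repr]

lemma exists_left_kernel_matrix {M : Matrix (Fin n) (Fin n) 𝕜} (hM : M.rank + k = n) :
    ∃ H : Matrix (Fin n) (Fin k) 𝕜, (Hᴴ * H).det ≠ 0 ∧ Hᴴ * M = 0 := by
  obtain ⟨H, hH, hMH, -⟩ := exists_kernel_matrix (M := Mᴴ) (k := k) (by
    rwa [Matrix.rank_conjTranspose])
  refine ⟨H, hH, ?_⟩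
  simpa using congrArg Matrix.conjTranspose hMH

lemma rank_add_le (M N : Matrix (Fin n) (Fin n) 𝕜) : (M + N).rank ≤ M.rank + N.rank := by
  rw [Matrix.rank, Matrix.rank, Matrix.rank, Matrix.mulVecLin_add]
  exact (Submodule.finrank_mono (LinearMap.range_add_le _ _)).trans
    (Submodule.finrank_add_le_finrank_add_finrank _ _)

lemma bddAbove_range_rank (A B : Matrix (Fin n) (Fin n) 𝕜) :
    BddAbove (Set.range fun z : 𝕜 => (A - z • B).rank) :=
  ⟨n, by rintro _ ⟨z, rfl⟩; simpa using Matrix.rank_le_width (A - z • B)⟩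

/-- The normal rank is attained at a point that is not an eigenvalue of a given diagonal pencil. -/
lemma exists_rank_eq_normalRank {A B : Matrix (Fin n) (Fin n) 𝕜} (hAB : normalRank A B + k = n)
    {z : 𝕜} {dA dB : Fin k → 𝕜} (hd : ∀ j, dA j - z * dB j ≠ 0) :
    ∃ w : 𝕜, (A - w • B).rank + k = n ∧ ∀ j, dA j - w * dB j ≠ 0 := by
  obtain ⟨w₀, hw₀⟩ : ∃ w₀ : 𝕜, (A - w₀ • B).rank = normalRank A B :=
    Nat.sSup_mem (Set.range_nonempty _) (bddAbove_range_rank A B)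
  obtain ⟨G, hG, -, hGs⟩ := exists_kernel_matrix (M := A - w₀ • B) (k := k) (by rw [hw₀, hAB])
  obtain ⟨H, hH, hHM⟩ := exists_left_kernel_matrix (M := A - w₀ • B) (k := k) (by rw [hw₀, hAB])
  -- A rank `k` completion that is nonsingular at `w₀` stays so nearby, which forces rank at least
  -- `n - k` there. One may thus move off `w₀`, the only point of a punctured neighbourhood's
  -- closure where a troublesome diagonal entry could vanish.
  have hdet : (A - w₀ • B + H * (1 : Matrix (Fin k) (Fin k) 𝕜) * Gᴴ).det ≠ 0 :=
    det_completion_ne_zero (by simp) hHM hH hGs hG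
  have h1 : ∀ᶠ w in nhdsWithin w₀ {w₀}ᶜ, (A - w • B + H * (1 : Matrix (Fin k) (Fin k) 𝕜) * Gᴴ).det ≠ 0 := by
    have hc : Continuous fun w : 𝕜 => (A - w • B + H * (1 : Matrix (Fin k) (Fin k) 𝕜) * Gᴴ).det :=
      Continuous.matrix_det ((continuous_const.sub (continuous_id.smul continuous_const)).add
        continuous_const)
    exact (hc.continuousAt.eventually_ne hdet).filter_mono nhdsWithin_le_nhds
  have h2 : ∀ j, ∀ᶠ w in nhdsWithin w₀ {w₀}ᶜ, dA j - w * dB j ≠ 0 := by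
    intro j
    by_cases h0 : dA j - w₀ * dB j = 0
    -- If `dB j = 0`, then `dA j = 0` as well, contradicting nonvanishing at `z`; so the entry has
    -- the single root `w₀`.
    · have hB : dB j ≠ 0 := by
        intro hB
        rw [hB, mul_zero, sub_zero] at h0
        exact hd j (by rw [hB, h0, mul_zero, sub_zero])
      filter_upwards [self_mem_nhdsWithin] with w hw h
      have h3 : (w₀ - w) * dB j = 0 := by linear_combination h - h0
      rcases mul_eq_zero.1 h3 with h4 | h4
      · exact hw (sub_eq_zero.1 h4).symm
      · exact hB h4
    · have hc : Continuous fun w : 𝕜 => dA j - w * dB j := by fun_prop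
      exact (hc.continuousAt.eventually_ne h0).filter_mono nhdsWithin_le_nhds
  obtain ⟨w, hw1, hw2⟩ := (h1.and (Filter.eventually_all.2 h2)).exists
  refine ⟨w, ?_, hw2⟩
  have hle : (A - w • B).rank ≤ normalRank A B := le_ciSup (bddAbove_range_rank A B) w
  have hfull : (A - w • B + H * (1 : Matrix (Fin k) (Fin k) 𝕜) * Gᴴ).rank = n := by
    simpa using Matrix.rank_of_isUnit _ ((Matrix.isUnit_iff_isUnit_det _).2 hw1.isUnit)
  have hadd := rank_add_le (A - w • B)
    (H * (1 : Matrix (Fin k) (Fin k) 𝕜) * Gᴴ)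
  have hHG : (H * (1 : Matrix (Fin k) (Fin k) 𝕜) * Gᴴ).rank ≤ k :=
    (Matrix.rank_mul_le_right _ _).trans (by simpa using Matrix.rank_le_height Gᴴ)
  omega

lemma modified_sub_smul_modified (A B : Matrix (Fin n) (Fin n) 𝕜) (τ : 𝕜) (dA dB : Fin k → 𝕜)
    (U V : Matrix (Fin n) (Fin k) 𝕜) (w : 𝕜) :
    modified A τ dA U V - w • modified B τ dB U V =
      A - w • B + U * Matrix.diagonal (fun j => τ * (dA j - w * dB j)) * Vᴴ := by
  have h : Matrix.diagonal (fun j => τ * (dA j - w * dB j)) =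
      τ • (Matrix.diagonal dA - w • Matrix.diagonal dB) := by
    ext i j
    by_cases hij : i = j
    · subst hij; simp
    · simp [hij]
  rw [h, modified, modified]
  simp only [Matrix.mul_smul, Matrix.smul_mul, Matrix.mul_sub, Matrix.sub_mul, smul_add, smul_sub,
    smul_comm w τ]
  abel

lemma det_diagonal_ne_zero {τ w : 𝕜} (hτ : τ ≠ 0) {dA dB : Fin k → 𝕜}
    (hd : ∀ j, dA j - w * dB j ≠ 0) :
    (Matrix.diagonal fun j => τ * (dA j - w * dB j)).det ≠ 0 := by
  rw [Matrix.det_diagonal]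
  exact Finset.prod_ne_zero_iff.2 fun j _ => mul_ne_zero hτ (hd j)

end Completion

/-! ### Coordinates in the kernel basis -/

section AdaptedBasis

variable {𝕜 : Type*} [RCLike 𝕜] {n k : ℕ} {A B : Matrix (Fin n) (Fin n) 𝕜} {z : 𝕜}
  {X₁ : Matrix (Fin n) (Fin k) 𝕜} {x : Fin n → 𝕜}

lemma IsAdaptedKernelBasis.conjTranspose_mul_self (h : IsAdaptedKernelBasis A B z X₁ x) :
    X₁ᴴ * X₁ = 1 := by
  ext i j
  have := congrFun (congrFun h.orthonormal (Sum.inl i)) (Sum.inl j)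
  simpa [Matrix.mul_apply, Matrix.one_apply] using this

lemma IsAdaptedKernelBasis.mul_eq_zero (h : IsAdaptedKernelBasis A B z X₁ x) :
    (A - z • B) * X₁ = 0 := by
  ext i j
  have h1 : X₁.col j ∈ LinearMap.ker (A - z • B).mulVecLin ⊓ minReducing A B := by
    rw [← h.span_left]
    exact Submodule.subset_span ⟨j, rfl⟩
  exact congrFun (LinearMap.mem_ker.1 h1.1) i

lemma IsAdaptedKernelBasis.exists_eq_mulVec (h : IsAdaptedKernelBasis A B z X₁ x) {v : Fin n → 𝕜}
    (hv : (A - z • B) *ᵥ v = 0) :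
    ∃ c, v = Matrix.fromCols X₁ (Matrix.replicateCol Unit x) *ᵥ c := by
  have h1 : v ∈ LinearMap.range (Matrix.fromCols X₁ (Matrix.replicateCol Unit x)).mulVecLin := by
    have h2 : insert x (Set.range X₁.col) ⊆
        Set.range (Matrix.fromCols X₁ (Matrix.replicateCol Unit x)).col := by
      rintro _ (rfl | ⟨j, rfl⟩)
      · exact ⟨Sum.inr (), rfl⟩
      · exact ⟨Sum.inl j, rfl⟩
    rw [Matrix.range_mulVecLin]
    refine Submodule.span_mono h2 ?_
    rw [h.span_all]
    exact LinearMap.mem_ker.2 hv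
  obtain ⟨c, hc⟩ := h1
  exact ⟨c, hc.symm⟩

end AdaptedBasis

/-! ### Compression of a uniform Stiefel matrix to the kernel -/

section Uniform

variable {𝕜 : Type*} [RCLike 𝕜] [MeasurableSpace 𝕜] [BorelSpace 𝕜] {n k : ℕ}

lemma IsUniformStiefel.ae_det_ne_zero {μ : Measure (Matrix (Fin n) (Fin k) 𝕜)}
    (hμ : IsUniformStiefel μ) {G : Matrix (Fin n) (Fin k) 𝕜} (hG : (Gᴴ * G).det ≠ 0) :
    ∀ᵐ V ∂μ, (Gᴴ * V).det ≠ 0 :=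
  have := hμ.isProbabilityMeasure
  ae_det_conjTranspose_mul_ne_zero hμ.invariant hμ.ae_mem hG

/-- The compression of a uniform random matrix to a subspace is invariant under unitary matrices. -/
lemma IsUniformStiefel.map_mul_map_conjTranspose_mul {ι : Type*} [Fintype ι] [DecidableEq ι]
    {μ : Measure (Matrix (Fin n) (Fin k) 𝕜)} (hμ : IsUniformStiefel μ) {X : Matrix (Fin n) ι 𝕜}
    (hX : Xᴴ * X = 1) {W : Matrix ι ι 𝕜} (hW : W ∈ Matrix.unitaryGroup ι 𝕜) :
    (μ.map fun Q => Xᴴ * Q).map (fun Q => W * Q) = μ.map fun Q => Xᴴ * Q := by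
  have hW' : Wᴴ * W = 1 := Matrix.mem_unitaryGroup_iff'.1 hW
  -- `T` acts as `W` on the range of `X` and as the identity on its orthogonal complement.
  let T : Matrix (Fin n) (Fin n) 𝕜 := X * W * Xᴴ + (1 - X * Xᴴ)
  have hXT : Xᴴ * T = W * Xᴴ := by
    simp only [T, Matrix.mul_add, Matrix.mul_sub, ← Matrix.mul_assoc, hX, Matrix.one_mul,
      Matrix.mul_one, sub_self, add_zero]
  have hT : Tᴴ * T = 1 := by
    have h1 : Tᴴ = X * Wᴴ * Xᴴ + (1 - X * Xᴴ) := by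
      simp [T, Matrix.mul_assoc]
    have h2 : (X * Wᴴ * Xᴴ) * T = X * Xᴴ := by
      rw [Matrix.mul_assoc, hXT, ← Matrix.mul_assoc, Matrix.mul_assoc X, hW', Matrix.mul_one]
    have h3 : (1 - X * Xᴴ) * T = 1 - X * Xᴴ := by
      rw [Matrix.sub_mul, Matrix.one_mul, Matrix.mul_assoc, hXT, ← Matrix.mul_assoc]
      simp [T]
    rw [h1, Matrix.add_mul, h2, h3]
    abel
  have hT' : T ∈ Matrix.unitaryGroup (Fin n) 𝕜 := Matrix.mem_unitaryGroup_iff'.2 hT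
  rw [Measure.map_map (measurable_matrix_mul_left _) (measurable_matrix_mul_left _)]
  have hcomp : (fun Q : Matrix ι (Fin k) 𝕜 => W * Q) ∘ (fun Q => Xᴴ * Q) =
      (fun Q => Xᴴ * Q) ∘ fun Q : Matrix (Fin n) (Fin k) 𝕜 => T * Q := by
    funext Q
    simp only [Function.comp_apply, ← Matrix.mul_assoc, hXT]
  rw [hcomp, ← Measure.map_map (measurable_matrix_mul_left _) (measurable_matrix_mul_left _),
    hμ.invariant T hT']

/-- The component along `x` of a unit vector of `ker (A - z B)` that is orthogonal to a uniformly
distributed random subspace is unlikely to be small. -/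
lemma IsUniformStiefel.measure_component_le {μ : Measure (Matrix (Fin n) (Fin k) 𝕜)}
    (hμ : IsUniformStiefel μ) {A B : Matrix (Fin n) (Fin n) 𝕜} {z : 𝕜}
    {X₁ : Matrix (Fin n) (Fin k) 𝕜} {x : Fin n → 𝕜} (h : IsAdaptedKernelBasis A B z X₁ x)
    {γ : Measure (Fin k ⊕ Unit → 𝕜)} {s : ℝ} {p : ℝ≥0∞} (hγ : IsComponentBound γ s p) :
    μ {V | ∃ v, star v ⬝ᵥ v = 1 ∧ (A - z • B) *ᵥ v = 0 ∧ Vᴴ *ᵥ v = 0 ∧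
      ‖component x v‖ ^ 2 ≤ s ^ 2} ≤ p := by
  have := hμ.isProbabilityMeasure
  obtain ⟨X, hX⟩ : ∃ X, X = Matrix.fromCols X₁ (Matrix.replicateCol Unit x) := ⟨_, rfl⟩
  have hXX : Xᴴ * X = 1 := by rw [hX]; exact h.orthonormal
  have hmeas : Measurable fun Q : Matrix (Fin n) (Fin k) 𝕜 => Xᴴ * Q :=
    measurable_matrix_mul_left _
  have hprob : IsProbabilityMeasure (μ.map fun Q => Xᴴ * Q) :=
    Measure.isProbabilityMeasure_map hmeas.aemeasurable
  have hinj : ∀ᵐ Z ∂(μ.map fun Q => Xᴴ * Q), Function.Injective Z.mulVec := by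
    have h0 : ∀ᵐ Z ∂(μ.map fun Q => Xᴴ * Q), (Zᴴ * Z).det ≠ 0 := by
      rw [ae_map_iff hmeas.aemeasurable]
      · filter_upwards [hμ.ae_det_ne_zero (G := X₁)
          (by rw [h.conjTranspose_mul_self, Matrix.det_one]; exact one_ne_zero)] with V hV
        -- `J` selects the rows of `Xᴴ V` that form `X₁ᴴ V`, and this block is already invertible.
        let J : Matrix (Fin k ⊕ Unit) (Fin k) 𝕜 := Matrix.fromRows 1 0
        have hJ : Jᴴ * (Xᴴ * V) = X₁ᴴ * V := by
          rw [← Matrix.mul_assoc, ← Matrix.conjTranspose_mul, hX, Matrix.fromCols_mul_fromRows]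
          simp
        exact det_gram_ne_zero_of_det_mul_ne_zero (G := J) (by rw [hJ]; exact hV)
      · apply IsOpen.measurableSet
        exact isOpen_ne_fun (Continuous.matrix_det (Continuous.matrix_mul
          (Continuous.matrix_conjTranspose continuous_id) continuous_id)) continuous_const
    filter_upwards [h0] with Z hZ using mulVec_injective_of_det_gram_ne_zero hZ
  refine le_trans ?_ (measure_exists_kernel_vector_le
    (fun W hW => hμ.map_mul_map_conjTranspose_mul hXX hW) hinj hγ)
  -- This direction of the pushforward inequality holds for arbitrary sets, so the event need not be
  -- measurable.
  refine le_trans (measure_mono ?_) (Measure.le_map_apply hmeas.aemeasurable _)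
  rintro V ⟨v, hv, hker, hVv, hs⟩
  obtain ⟨c, hc⟩ := h.exists_eq_mulVec hker
  rw [← hX] at hc
  have hXv : Xᴴ *ᵥ v = c := by rw [hc, Matrix.mulVec_mulVec, hXX, Matrix.one_mulVec]
  refine ⟨c, ?_, ?_, ?_⟩
  · rw [hc, Matrix.star_mulVec, ← Matrix.dotProduct_mulVec, Matrix.mulVec_mulVec, hXX,
      Matrix.one_mulVec] at hv
    exact hv
  · rw [Matrix.conjTranspose_mul, Matrix.conjTranspose_conjTranspose, ← Matrix.mulVec_mulVec, ← hc,
      hVv]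
  · have h1 : c (Sum.inr ()) = component x v := by
      rw [← hXv, hX]
      rfl
    rw [h1]
    exact hs

end Uniform

/-! ### Union bound for the two eigenvectors -/

section Main

variable {𝕜 : Type*} [RCLike 𝕜] [MeasurableSpace 𝕜] [BorelSpace 𝕜] {n k : ℕ}
  {Ω : Type*} [MeasurableSpace Ω] {P : Measure Ω} {A B : Matrix (Fin n) (Fin n) 𝕜} {z : 𝕜}
  {X₁ : Matrix (Fin n) (Fin k) 𝕜} {x : Fin n → 𝕜} {Y₁ : Matrix (Fin n) (Fin k) 𝕜} {y : Fin n → 𝕜}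
  {τ : 𝕜} {dA dB : Fin k → 𝕜} {U V : Ω → Matrix (Fin n) (Fin k) 𝕜} {xi yi : Ω → Fin n → 𝕜}

/-- The modified pencil is almost surely regular. -/
lemma Setting.ae_isRegularPencil (h : Setting P A B z X₁ x Y₁ y τ dA dB U V xi yi) :
    ∀ᵐ ω ∂P, IsRegularPencil (modified A τ dA (U ω) (V ω)) (modified B τ dB (U ω) (V ω)) := by
  obtain ⟨w, hw, hd⟩ := exists_rank_eq_normalRank h.normalRank_add h.not_prescribed
  obtain ⟨G, hG, -, hGs⟩ := exists_kernel_matrix hw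
  obtain ⟨H, hH, hHM⟩ := exists_left_kernel_matrix hw
  filter_upwards [ae_of_ae_map h.measurable_U.aemeasurable (h.uniform_U.ae_det_ne_zero hH),
    ae_of_ae_map h.measurable_V.aemeasurable (h.uniform_V.ae_det_ne_zero hG)] with ω hU hV
  refine ⟨w, ?_⟩
  rw [modified_sub_smul_modified]
  exact det_completion_ne_zero (det_diagonal_ne_zero h.tau_ne_zero hd) hHM hU hGs hV

/-- A product below `t` has a factor at most `√t`. Each alternative is contained in an event about
`V` alone or `U` alone, so neither independence nor measurability of the eigenvectors plays a role.
-/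
lemma Setting.measure_component_mul_component_lt_le
    (h : Setting P A B z X₁ x Y₁ y τ dA dB U V xi yi) {γ : Measure (Fin k ⊕ Unit → 𝕜)} {t : ℝ}
    (ht : 0 ≤ t) {p : ℝ≥0∞} (hγ : IsComponentBound γ (Real.sqrt t) p) :
    P {ω | ‖component x (xi ω)‖ * ‖component y (yi ω)‖ < t} ≤ p + p := by
  have hX := h.basis_right
  have hY := h.basis_left
  have hadj : Aᴴ - star z • Bᴴ = (A - z • B)ᴴ := by
    rw [Matrix.conjTranspose_sub, Matrix.conjTranspose_smul]
  have hYM : Y₁ᴴ * (A - z • B) = 0 := by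
    have := hY.mul_eq_zero
    rw [hadj] at this
    simpa using congrArg Matrix.conjTranspose this
  have hXM : X₁ᴴ * (A - z • B)ᴴ = 0 := by
    rw [← Matrix.conjTranspose_mul, hX.mul_eq_zero, Matrix.conjTranspose_zero]
  have hDdet := det_diagonal_ne_zero h.tau_ne_zero h.not_prescribed
  have hsub : {ω | ‖component x (xi ω)‖ * ‖component y (yi ω)‖ < t} ≤ᵐ[P]
      (V ⁻¹' {V | ∃ v, star v ⬝ᵥ v = 1 ∧ (A - z • B) *ᵥ v = 0 ∧ Vᴴ *ᵥ v = 0 ∧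
        ‖component x v‖ ^ 2 ≤ Real.sqrt t ^ 2} ∪
      U ⁻¹' {U | ∃ v, star v ⬝ᵥ v = 1 ∧ (Aᴴ - star z • Bᴴ) *ᵥ v = 0 ∧ Uᴴ *ᵥ v = 0 ∧
        ‖component y v‖ ^ 2 ≤ Real.sqrt t ^ 2} : Set Ω) := by
    filter_upwards [h.ae_isRegularPencil, h.eigenvector_right, h.eigenvector_left,
      ae_of_ae_map h.measurable_U.aemeasurable (h.uniform_U.ae_det_ne_zero (G := Y₁)
        (by rw [hY.conjTranspose_mul_self, Matrix.det_one]; exact one_ne_zero)),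
      ae_of_ae_map h.measurable_V.aemeasurable (h.uniform_V.ae_det_ne_zero (G := X₁)
        (by rw [hX.conjTranspose_mul_self, Matrix.det_one]; exact one_ne_zero))]
      with ω hreg hxi hyi hU hV hlt
    have hx := hxi hreg
    have hy := hyi hreg
    have hlt : ‖component x (xi ω)‖ * ‖component y (yi ω)‖ < t := hlt
    have hxk := hx.mulVec_eq_zero
    rw [modified_sub_smul_modified] at hxk
    -- The adjoint of the left eigenvector equation is a completion of `(A - z • B)ᴴ` in which `U`
    -- and `V` trade places.
    have hyk := congrArg star hy.vecMul_eq_zero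
    rw [modified_sub_smul_modified, Matrix.star_vecMul, star_star, star_zero,
      Matrix.conjTranspose_add, Matrix.conjTranspose_mul, Matrix.conjTranspose_mul,
      Matrix.conjTranspose_conjTranspose, ← Matrix.mul_assoc] at hyk
    obtain ⟨hx1, hx2⟩ := mulVec_eq_zero_of_completion hDdet hYM hU hxk
    obtain ⟨hy1, hy2⟩ := mulVec_eq_zero_of_completion
      (by rw [Matrix.det_conjTranspose]; exact star_ne_zero.2 hDdet) hXM hV hyk
    by_cases hxs : ‖component x (xi ω)‖ ^ 2 ≤ Real.sqrt t ^ 2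
    · exact Or.inl ⟨xi ω, hx.norm_eq_one, hx2, hx1, hxs⟩
    · refine Or.inr ⟨yi ω, hy.norm_eq_one, by rwa [hadj], hy1, ?_⟩
      rw [not_le, sq_lt_sq₀ (Real.sqrt_nonneg t) (norm_nonneg _)] at hxs
      rw [sq_le_sq₀ (norm_nonneg _) (Real.sqrt_nonneg t)]
      by_contra hys
      rw [not_le] at hys
      have := mul_lt_mul'' hxs hys (Real.sqrt_nonneg t) (Real.sqrt_nonneg t)
      rw [Real.mul_self_sqrt ht] at this
      linarith
  calc _ ≤ _ := measure_mono_ae hsub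
    _ ≤ _ := measure_union_le _ _
    _ ≤ p + p := add_le_add
      ((Measure.le_map_apply h.measurable_V.aemeasurable _).trans
        (h.uniform_V.measure_component_le hX hγ))
      ((Measure.le_map_apply h.measurable_U.aemeasurable _).trans
        (h.uniform_U.measure_component_le hY hγ))

lemma Setting.measureReal_component_mul_component_lt_le [IsProbabilityMeasure P]
    (h : Setting P A B z X₁ x Y₁ y τ dA dB U V xi yi) {γ : Measure (Fin k ⊕ Unit → 𝕜)} {t : ℝ}
    (ht : 0 ≤ t) {p : ℝ} (hp : 0 ≤ p) (hγ : IsComponentBound γ (Real.sqrt t) (ENNReal.ofReal p)) :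
    P.real {ω | ‖component x (xi ω)‖ * ‖component y (yi ω)‖ < t} ≤ 2 * p := by
  have h1 := h.measure_component_mul_component_lt_le ht hγ
  rw [← ENNReal.ofReal_add hp hp, ← two_mul] at h1
  exact ENNReal.toReal_le_of_le_ofReal (by positivity) h1

end Main

end SingularPencil

theorem corollary4p7 {Ω : Type*} [MeasurableSpace Ω] (P : MeasureTheory.Measure Ω)
    [MeasureTheory.IsProbabilityMeasure P] (n k : ℕ) :
    (∀ (A B : Matrix (Fin n) (Fin n) ℂ) (z : ℂ)
        (X₁ : Matrix (Fin n) (Fin k) ℂ) (x : Fin n → ℂ)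
        (Y₁ : Matrix (Fin n) (Fin k) ℂ) (y : Fin n → ℂ)
        (τ : ℂ) (dA dB : Fin k → ℂ) (U V : Ω → Matrix (Fin n) (Fin k) ℂ)
        (xi yi : Ω → Fin n → ℂ),
      SingularPencil.Setting P A B z X₁ x Y₁ y τ dA dB U V xi yi →
      ∀ t : ℝ, 0 ≤ t → t ≤ 1 →
        P.real {ω | ‖SingularPencil.component x (xi ω)‖ *
            ‖SingularPencil.component y (yi ω)‖ < t} ≤ 2 * k * t) ∧
    (∀ (A B : Matrix (Fin n) (Fin n) ℝ) (z : ℝ)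
        (X₁ : Matrix (Fin n) (Fin k) ℝ) (x : Fin n → ℝ)
        (Y₁ : Matrix (Fin n) (Fin k) ℝ) (y : Fin n → ℝ)
        (τ : ℝ) (dA dB : Fin k → ℝ) (U V : Ω → Matrix (Fin n) (Fin k) ℝ)
        (xi yi : Ω → Fin n → ℝ),
      SingularPencil.Setting P A B z X₁ x Y₁ y τ dA dB U V xi yi →
      ∀ t : ℝ, 0 ≤ t → t ≤ 1 →
        P.real {ω | ‖SingularPencil.component x (xi ω)‖ *
            ‖SingularPencil.component y (yi ω)‖ < t} ≤ Real.sqrt (8 * k * t / Real.pi)) := by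
  constructor
  · intro A B z X₁ x Y₁ y τ dA dB U V xi yi h t ht ht1
    have hk : (1 : ℝ) ≤ k := by exact_mod_cast h.one_le
    -- At `t = 1` the slope `s / √(1 - s²)` degenerates, but the bound `2k` exceeds one.
    rcases ht1.lt_or_eq with ht1 | rfl
    · have : Nonempty (Fin k) := ⟨⟨0, h.one_le⟩⟩
      obtain ⟨γ, hγ⟩ := SingularPencil.exists_isComponentBound_complex (m := Fin k)
        (Real.sqrt_nonneg t) ((Real.sqrt_lt' one_pos).2 (by linarith))
      rw [Fintype.card_fin, Real.sq_sqrt ht] at hγ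
      have := h.measureReal_component_mul_component_lt_le ht (by positivity) hγ
      linarith
    · exact measureReal_le_one.trans (by linarith)
  · intro A B z X₁ x Y₁ y τ dA dB U V xi yi h t ht ht1
    have hk : (1 : ℝ) ≤ k := by exact_mod_cast h.one_le
    -- The component estimate needs `s² = t ≤ 1/2`; beyond that `8kt/π ≥ 4/π ≥ 1` and the bound is
    -- trivial.
    rcases le_or_gt t (1 / 2) with ht2 | ht2
    · have : Nonempty (Fin k) := ⟨⟨0, h.one_le⟩⟩
      obtain ⟨γ, hγ⟩ := SingularPencil.exists_isComponentBound_real (m := Fin k)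
        (Real.sqrt_nonneg t) (by rwa [Real.sq_sqrt ht])
      rw [Fintype.card_fin, ← Real.sqrt_mul ht] at hγ
      refine (h.measureReal_component_mul_component_lt_le ht (Real.sqrt_nonneg _) hγ).trans_eq ?_
      have h4 : (2 : ℝ) = Real.sqrt 4 := by
        rw [show (4 : ℝ) = 2 ^ 2 by norm_num, Real.sqrt_sq two_pos.le]
      nth_rw 1 [h4]
      rw [← Real.sqrt_mul (by norm_num)]
      congr 1
      ring
    · refine measureReal_le_one.trans ?_
      rw [Real.one_le_sqrt, le_div_iff₀ Real.pi_pos]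
      nlinarith [Real.pi_le_four]
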